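/- \textbf{Formulas.} Formulas are built from propositional variables $p_0,p_1,\dots$ and $\bot$ by $\to$, $\Box$, $\Box^+$; $\neg A:=A\to\bot$ and $A\wedge B:=\neg(A\to\neg B)$. \textbf{The calculus $\mathsf K^+$.} Its axioms are the classical tautologies (in the modal language) and the formulas $\Box(A\to B)\to(\Box A\to\Box B)$, $\Box^+(A\to B)\to(\Box^+A\to\Box^+B)$, $\Box^+A\to\Box A\wedge\Box\Box^+A$, $\Box A\wedge\Box^+(A\to\Box A)\to\Box^+A$; its rules are modus ponens and necessitation $A/\Box^+A$. An $\omega$-derivation is a well-founded tree of formulas built with these two rules and the rule $(\omega)$ with premises $B_n\to\Box(A\wedge B_{n+1})$, $n\in\mathbb N$, and conclusion $B_0\to\Box^+A$; all premises of $(\omega)$ except the one with $n=0$ are called boxed. An assumption leaf is a leaf not marked by an axiom; it is boxed if the path from the root to it meets an application of necessitation or passes through a boxed premise of $(\omega)$. For sets of formulas $\Sigma,\Gamma$ we write $\Sigma;\Gamma\vdash A$ if $A$ is the root of an $\omega$-derivation without applications of $(\omega)$ in which all boxed assumption leaves are marked by formulas from $\Sigma$ and all non-boxed ones by formulas from $\Gamma$.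 \textbf{The calculus $\mathsf S+\mathsf{cut}$.} A sequent is $\Sigma;\Gamma\Rightarrow\Delta$ with $\Sigma$ an arbitrary set of formulas and $\Gamma,\Delta$ finite multisets of formulas. The initial sequents are $\Sigma;\Gamma,p\Rightarrow p,\Delta$ ($p$ a variable) and $\Sigma;\Gamma,\bot\Rightarrow\Delta$. The rules are (with premises listed from left to right) \begin{itemize} \item $(\to_L)$: from $\Sigma;\Gamma,B\Rightarrow\Delta$ and $\Sigma;\Gamma\Rightarrow A,\Delta$ infer $\Sigma;\Gamma,A\to B\Rightarrow\Delta$; \item $(\to_R)$: from $\Sigma;\Gamma,A\Rightarrow B,\Delta$ infer $\Sigma;\Gamma\Rightarrow A\to B,\Delta$; \item $(\Box)$: from $\Sigma;\Sigma_0,\Lambda,\Pi,\Box^+\Pi\Rightarrow A$ infer $\Sigma;\Phi,\Box\Lambda,\Box^+\Pi\Rightarrow\Box A,\Psi$, where $\Sigma_0$ is a finite subset of $\Sigma$; \item $(\Box^+)$: from $\Sigma;\Sigma_0,\Lambda,\Pi,\Box^+\Pi\Rightarrow A$ and $\Sigma;\Sigma_0,\Lambda,\Pi,\Box^+\Pi\Rightarrow\Box^+A$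 infer $\Sigma;\Phi,\Box\Lambda,\Box^+\Pi\Rightarrow\Box^+A,\Psi$, where $\Sigma_0$ is a finite subset of $\Sigma$ and $\Box^+A$ is called the principal formula; \item $(\mathsf{cut})$: from $\Sigma;\Gamma\Rightarrow A,\Delta$ and $\Sigma;\Gamma,A\Rightarrow\Delta$ infer $\Sigma;\Gamma\Rightarrow\Delta$. \end{itemize} An $\infty$-proof is a possibly infinite tree of sequents built by these rules, in which all leaves are initial sequents and every infinite branch has a tail such that (a) all applications of $(\Box^+)$ in the tail have the same principal formula; (b) the tail passes through the right premise of $(\Box^+)$ infinitely many times; (c) it does not pass through the left premise of $(\Box^+)$; (d) it contains no application of $(\Box)$. An $\infty$-proof is regular if it has only finitely many pairwise non-isomorphic subtrees, and cut-free if it contains no application of $(\mathsf{cut})$. \textbf{Proposition.} Let $\Sigma$ be a set of formulas, $\Gamma$ a finite multiset of formulas (read as the set of its elements on the left of $\vdash$), and $A$ a formula. Then $\Sigma;\Gamma\vdash A$ if and only if the sequent $\Sigma;\Gamma\Rightarrow A$ has a regular $\infty$-proof in $\mathsf S+\mathsf{cut}$. Moreover, $\Sigma;\Gamma\vdash A$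 if and only if $\Sigma;\Gamma\Rightarrow A$ has a regular cut-free $\infty$-proof. -/

import Mathlib

namespace KPlus

/-- Formulas of the bimodal logic of transitive closure: propositional variables, falsum,
implication, and the two modalities `Box` and `Box⁺`. -/
inductive Fm : Type
  | var : ℕ → Fm
  | bot : Fm
  | imp : Fm → Fm → Fm
  | box : Fm → Fm
  | boxp : Fm → Fm

namespace Fm

/-- Negation, as the abbreviation `A → ⊥`. -/
def neg (A : Fm) : Fm := imp A bot

/-- Conjunction, as the abbreviation `¬ (A → ¬ B)`. -/
def and (A B : Fm) : Fm := neg (imp A (neg B))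

/-- Boolean value of a formula, where variables and formulas that begin with a modality
are treated as atoms, valued by `v`. -/
def eval (v : Fm → Prop) : Fm → Prop
  | bot => False
  | imp A B => eval v A → eval v B
  | var n => v (var n)
  | box A => v (box A)
  | boxp A => v (boxp A)

/-- Classical tautologies in the modal language. -/
def IsTautology (A : Fm) : Prop := ∀ v : Fm → Prop, eval v A

end Fm

open Fm

/-- The schemes (i)-(v) of the Frege-Hilbert calculus of `K⁺`. -/
inductive KAx : Fm → Prop
  | taut (A : Fm) : IsTautology A → KAx A
  | boxK (A B : Fm) : KAx (imp (box (imp A B)) (imp (box A) (box B)))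
  | boxpK (A B : Fm) : KAx (imp (boxp (imp A B)) (imp (boxp A) (boxp B)))
  | unfold (A : Fm) : KAx (imp (boxp A) (and (box A) (box (boxp A))))
  | ind (A : Fm) : KAx (imp (and (box A) (boxp (imp A (box A)))) (boxp A))

/-- `OmegaDer A` is the type of `ω`-derivations whose root is marked by `A`: well-founded
trees of formulas built with the rules (mp), (nec) and (ω), with arbitrary formulas
at the leaves. -/
inductive OmegaDer : Fm → Type
  | leaf (A : Fm) : OmegaDer A
  | mp {A B : Fm} : OmegaDer A → OmegaDer (imp A B) → OmegaDer B
  | nec {A : Fm} : OmegaDer A → OmegaDer (boxp A)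
  | omega (A : Fm) (B : ℕ → Fm) :
      (∀ n, OmegaDer (imp (B n) (box (and A (B (n + 1)))))) →
        OmegaDer (imp (B 0) (boxp A))

namespace OmegaDer

/-- Formulas at the non-boxed assumption leaves. A leaf is an assumption leaf if it is not
marked by one of the schemes (i)-(v). -/
def nonboxed : {A : Fm} → OmegaDer A → Set Fm
  | _, leaf A => {C | C = A ∧ ¬ KAx A}
  | _, mp d e => nonboxed d ∪ nonboxed e
  | _, nec _ => ∅
  | _, omega _ _ d => nonboxed (d 0)

/-- Formulas at the boxed assumption leaves: those above an application of (nec) or above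
a premise of (ω) other than the leftmost one. -/
def boxed : {A : Fm} → OmegaDer A → Set Fm
  | _, leaf _ => ∅
  | _, mp d e => boxed d ∪ boxed e
  | _, nec d => boxed d ∪ nonboxed d
  | _, omega _ _ d => boxed (d 0) ∪ ⋃ n : ℕ, (boxed (d (n + 1)) ∪ nonboxed (d (n + 1)))

/-- The derivation contains no application of the rule (ω). -/
def OmegaFree : {A : Fm} → OmegaDer A → Prop
  | _, leaf _ => True
  | _, mp d e => OmegaFree d ∧ OmegaFree e
  | _, nec d => OmegaFree d
  | _, omega _ _ _ => False

end OmegaDer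

/-- The relation `S ; G ⊢ A` of the ordinary calculus `K⁺`. -/
def Derives (S G : Set Fm) (A : Fm) : Prop :=
  ∃ d : OmegaDer A, d.OmegaFree ∧ d.boxed ⊆ S ∧ d.nonboxed ⊆ G

/-- Sequents `ctx ; ant ⇒ suc`: `ctx` is an arbitrary set of formulas, `ant` and `suc` are
finite multisets. -/
structure Sequent : Type where
  ctx : Set Fm
  ant : Multiset Fm
  suc : Multiset Fm

/-- Names of the rules of `S + cut`; `init` stands for the initial sequents, and a modal rule
is recorded with the formula under the modality of its principal formula. -/
inductive Rule : Type
  | init : Rule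
  | impL : Rule
  | impR : Rule
  | box : Fm → Rule
  | boxp : Fm → Rule
  | cut : Rule

/-- `RuleInst r s l`: there is an instance of the rule `r` with conclusion `s` and with the list
of premises `l` (from left to right). -/
inductive RuleInst : Rule → Sequent → List Sequent → Prop
  | initVar (S : Set Fm) (G D : Multiset Fm) (p : ℕ) :
      RuleInst Rule.init ⟨S, G + {var p}, {var p} + D⟩ []
  | initBot (S : Set Fm) (G D : Multiset Fm) :
      RuleInst Rule.init ⟨S, G + {bot}, D⟩ []
  | impL (S : Set Fm) (G D : Multiset Fm) (A B : Fm) :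
      RuleInst Rule.impL ⟨S, G + {imp A B}, D⟩ [⟨S, G + {B}, D⟩, ⟨S, G, {A} + D⟩]
  | impR (S : Set Fm) (G D : Multiset Fm) (A B : Fm) :
      RuleInst Rule.impR ⟨S, G, {imp A B} + D⟩ [⟨S, G + {A}, {B} + D⟩]
  | box (S : Set Fm) (S₀ : Finset Fm) (hS : (S₀ : Set Fm) ⊆ S) (L P F R : Multiset Fm) (A : Fm) :
      RuleInst (Rule.box A) ⟨S, F + L.map Fm.box + P.map Fm.boxp, {Fm.box A} + R⟩
        [⟨S, S₀.val + L + P + P.map Fm.boxp, {A}⟩]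
  | boxp (S : Set Fm) (S₀ : Finset Fm) (hS : (S₀ : Set Fm) ⊆ S) (L P F R : Multiset Fm) (A : Fm) :
      RuleInst (Rule.boxp A) ⟨S, F + L.map Fm.box + P.map Fm.boxp, {Fm.boxp A} + R⟩
        [⟨S, S₀.val + L + P + P.map Fm.boxp, {A}⟩,
          ⟨S, S₀.val + L + P + P.map Fm.boxp, {Fm.boxp A}⟩]
  | cut (S : Set Fm) (G D : Multiset Fm) (A : Fm) :
      RuleInst Rule.cut ⟨S, G, D⟩ [⟨S, G, {A} + D⟩, ⟨S, G + {A}, D⟩]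

/-- Possibly infinite ordered trees whose nodes are marked by sequents. A node is addressed by
the list of child indices on the path from the root to it; the value is `none` at addresses
that are not nodes of the tree. -/
abbrev SeqTree : Type := List ℕ → Option Sequent

namespace SeqTree

/-- The address `a` is a node of the tree. -/
def IsNode (t : SeqTree) (a : List ℕ) : Prop := (t a).isSome

/-- The subtree whose root is at the address `a`. -/
def subtree (t : SeqTree) (a : List ℕ) : SeqTree := fun c => t (a ++ c)

/-- The node `a` together with its children is an application of the rule `r`. The sequents
at a node and its children determine the rule (and the formula recorded in it) uniquely. -/
def AppliesAt (t : SeqTree) (a : List ℕ) (r : Rule) : Prop :=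
  ∃ (s : Sequent) (l : List Sequent),
    t a = some s ∧ RuleInst r s l ∧ ∀ i : ℕ, t (a ++ [i]) = l[i]?

/-- The node at height `n` on the path that takes the child of index `b k` at height `k`. -/
def branchNode (b : ℕ → ℕ) (n : ℕ) : List ℕ := (List.range n).map b

/-- `b` describes an infinite branch of the tree. -/
def IsInfiniteBranch (t : SeqTree) (b : ℕ → ℕ) : Prop := ∀ n, t.IsNode (branchNode b n)

/-- The condition on an infinite branch: it has a tail, from height `N` on, such that, for
some formula `A`, all applications of (Box⁺) in the tail have the principal formula `Box⁺ A`,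
the tail passes through the right premise (child 1) of (Box⁺) infinitely many times and never
through the left premise (child 0), and there is no application of (Box) in the tail. -/
def GoodBranch (t : SeqTree) (b : ℕ → ℕ) : Prop :=
  ∃ (N : ℕ) (A : Fm),
    (∀ n ≥ N, ∀ B : Fm, t.AppliesAt (branchNode b n) (Rule.boxp B) → B = A) ∧
    (∀ m : ℕ, ∃ n ≥ m, N ≤ n ∧
      (∃ B : Fm, t.AppliesAt (branchNode b n) (Rule.boxp B)) ∧ b n = 1) ∧
    (∀ n ≥ N, ∀ B : Fm, t.AppliesAt (branchNode b n) (Rule.boxp B) → b n ≠ 0) ∧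
    (∀ n ≥ N, ∀ B : Fm, ¬ t.AppliesAt (branchNode b n) (Rule.box B))

/-- `∞`-proofs of the calculus `S + cut`. -/
structure IsInfProof (t : SeqTree) : Prop where
  root : t.IsNode []
  closed : ∀ (a : List ℕ) (i : ℕ), t.IsNode (a ++ [i]) → t.IsNode a
  rules : ∀ a : List ℕ, t.IsNode a → ∃ r : Rule, t.AppliesAt a r
  branches : ∀ b : ℕ → ℕ, t.IsInfiniteBranch b → t.GoodBranch b

/-- There are no applications of (cut). -/
def CutFree (t : SeqTree) : Prop := ∀ a : List ℕ, ¬ t.AppliesAt a Rule.cut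

/-- There are only finitely many non-isomorphic subtrees. Premises of one rule instance are
different sequents, so an isomorphism of subtrees of a proof keeps the order of the children,
and isomorphic subtrees are equal as functions on addresses. -/
def Regular (t : SeqTree) : Prop := {u : SeqTree | ∃ a, t.IsNode a ∧ u = t.subtree a}.Finite

end SeqTree

/-- The sequent `s` is provable in `S + cut` by a regular `∞`-proof. -/
def RegProvable (s : Sequent) : Prop :=
  ∃ t : SeqTree, t.IsInfProof ∧ t [] = some s ∧ t.Regular

/-- The sequent `s` is provable by a regular cut-free `∞`-proof. -/
def RegCutFreeProvable (s : Sequent) : Prop :=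
  ∃ t : SeqTree, t.IsInfProof ∧ t [] = some s ∧ t.Regular ∧ t.CutFree

end KPlus

/-! Two implications suffice: a Hilbert derivation yields a regular cut-free `∞`-proof, and a
regular `∞`-proof with cuts yields a Hilbert derivation. Cut elimination is thus semantic, through
Kripke models where □ is read along a relation and □⁺ along its transitive closure.

The core is one countermodel theorem for two notions of provability. A set `P` of sequents is
`StepClosed` if it absorbs every finite set `Y` whose members follow by cut-free rules from `P` and
`Y`, where premises from `Y` are allowed only in the implication rules and on the right of (□⁺) with
one fixed principal formula. A sequent outside such a `P` has a countermodel whose accessible worlds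
are saturated sequents of bounded weight outside `P` (`StepClosed.exists_countermodel`, resting on
`StepClosed.truth`).

Cut-free regular provability is closed because the finite graph on `Y` unfolds into a regular proof
(`stepClosed_regCutFree`); with `Hil.sound` this gives completeness without cut. Refutability in the
Hilbert calculus is closed because `Y` provides an invariant for the induction axiom
(`stepClosed_refutes`); with `SeqTree.IsInfProof.sound` this turns `∞`-proofs into derivations.

The countermodels enforce only a finite part of the context. That is enough: a Hilbert derivation is
finite, and a regular `∞`-proof has finitely many subtrees, so each uses finitely many context
formulas. -/

namespace KPlus
open Fm

/-! ### The Hilbert calculus as an inductive predicate -/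

/-- `Hil S G A`: the formula `A` is derivable from global assumptions `S` and local
assumptions `G`. -/
inductive Hil (S : Set Fm) : Set Fm → Fm → Prop
  | asm {G : Set Fm} {A : Fm} : A ∈ G → Hil S G A
  | ax {G : Set Fm} {A : Fm} : KAx A → Hil S G A
  | mp {G : Set Fm} {A B : Fm} : Hil S G A → Hil S G (imp A B) → Hil S G B
  | nec {G : Set Fm} {A : Fm} : Hil S S A → Hil S G (boxp A)

theorem OmegaDer.hil {A : Fm} (d : OmegaDer A) :
    ∀ S G : Set Fm, d.OmegaFree → d.boxed ⊆ S → d.nonboxed ⊆ G → Hil S G A := by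
  induction d with
  | leaf A =>
    intro S G _ _ h
    by_cases hA : KAx A
    · exact .ax hA
    · exact .asm (h ⟨rfl, hA⟩)
  | mp d e ihd ihe =>
    intro S G hf hb hn
    exact .mp (ihd S G hf.1 (Set.subset_union_left.trans hb) (Set.subset_union_left.trans hn))
      (ihe S G hf.2 (Set.subset_union_right.trans hb) (Set.subset_union_right.trans hn))
  | nec d ih =>
    intro S G hf hb _
    exact .nec (ih S S hf (Set.subset_union_left.trans hb) (Set.subset_union_right.trans hb))
  | omega A B d _ =>
    intro S G hf
    exact hf.elim

theorem derives_iff_hil {S G : Set Fm} {A : Fm} : Derives S G A ↔ Hil S G A := by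
  constructor
  · rintro ⟨d, hf, hb, hn⟩
    exact d.hil S G hf hb hn
  · intro h
    induction h with
    | asm h => exact ⟨.leaf _, trivial, Set.empty_subset _, fun C hC => hC.1 ▸ h⟩
    | ax h => exact ⟨.leaf _, trivial, Set.empty_subset _, fun C hC => (hC.2 h).elim⟩
    | mp _ _ ih₁ ih₂ =>
      obtain ⟨d, hd, hd₁, hd₂⟩ := ih₁
      obtain ⟨e, he, he₁, he₂⟩ := ih₂
      exact ⟨.mp d e, ⟨hd, he⟩, Set.union_subset hd₁ he₁, Set.union_subset hd₂ he₂⟩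
    | nec _ ih =>
      obtain ⟨d, hd, hd₁, hd₂⟩ := ih
      exact ⟨.nec d, hd, Set.union_subset hd₁ hd₂, Set.empty_subset _⟩

namespace Hil

variable {S G : Set Fm} {A B C : Fm}

theorem mono (h : Hil S G A) : ∀ {S' G' : Set Fm}, S ⊆ S' → G ⊆ G' → Hil S' G' A := by
  induction h with
  | asm h => exact fun _ hG => .asm (hG h)
  | ax h => exact fun _ _ => .ax h
  | mp _ _ ih₁ ih₂ => exact fun hS hG => .mp (ih₁ hS hG) (ih₂ hS hG)
  | nec _ ih => exact fun hS _ => .nec (ih hS hS)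

theorem weaken (h : Hil S G A) {G' : Set Fm} (hG : G ⊆ G') : Hil S G' A :=
  h.mono subset_rfl hG

/-- Reduces an infinite context to a finite part, the only part that a countermodel can be made to
satisfy. -/
theorem compact (h : Hil S G A) :
    ∃ F E : Finset Fm, (F : Set Fm) ⊆ S ∧ (E : Set Fm) ⊆ G ∧ Hil (F : Set Fm) (E : Set Fm) A := by
  classical
  induction h with
  | @asm G A h => exact ⟨∅, {A}, by simp, by simpa using h, .asm (by simp)⟩
  | ax h => exact ⟨∅, ∅, by simp, by simp, .ax h⟩
  | mp _ _ ih₁ ih₂ =>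
    obtain ⟨F₁, E₁, hF₁, hE₁, h₁⟩ := ih₁
    obtain ⟨F₂, E₂, hF₂, hE₂, h₂⟩ := ih₂
    refine ⟨F₁ ∪ F₂, E₁ ∪ E₂, by simp [hF₁, hF₂], by simp [hE₁, hE₂], ?_⟩
    exact .mp (h₁.mono (by simp) (by simp)) (h₂.mono (by simp) (by simp))
  | nec _ ih =>
    obtain ⟨F, E, hF, hE, h⟩ := ih
    exact ⟨F ∪ E, ∅, by simp [hF, hE], by simp, .nec (h.mono (by simp) (by simp))⟩

theorem taut (h : IsTautology A) : Hil S G A := .ax (.taut _ h)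

/-- Necessitated subderivations rely on `S` alone, so discharging a local assumption leaves them
untouched. -/
theorem deduction (h : Hil S (insert A G) B) : Hil S G (imp A B) := by
  generalize hG' : insert A G = G' at h
  induction h generalizing G with
  | @asm G' B h =>
    subst hG'
    rcases h with rfl | h
    · exact taut fun v hv => hv
    · exact .mp (.asm h) (taut fun v hv _ => hv)
  | ax h => exact .mp (.ax h) (taut fun v hv _ => hv)
  | mp _ _ ih₁ ih₂ =>
    exact .mp (ih₂ hG') (.mp (ih₁ hG') (taut fun v h₁ h₂ h => h₂ h (h₁ h)))
  | nec h _ => exact .mp (.nec h) (taut fun v hv _ => hv)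

theorem subst {X : Set Fm} (h : Hil S X A) (hX : ∀ B ∈ X, Hil S G B) : Hil S G A := by
  induction h with
  | asm h => exact hX _ h
  | ax h => exact .ax h
  | mp _ _ ih₁ ih₂ => exact .mp (ih₁ hX) (ih₂ hX)
  | nec h _ => exact .nec h

theorem trans (h₁ : Hil S G A) (h₂ : Hil S (insert A G) B) : Hil S G B :=
  .mp h₁ h₂.deduction

theorem exfalso (h : Hil S G bot) : Hil S G A := .mp h (taut fun _ hv => hv.elim)

theorem contra (h₁ : Hil S G A) (h₂ : Hil S G (neg A)) : Hil S G B := (mp h₁ h₂).exfalso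

theorem by_contra (h : Hil S (insert (neg A) G) bot) : Hil S G A :=
  .mp h.deduction (taut fun _ hv => _root_.by_contra hv)

theorem cases_neg (C : Fm) (h₁ : Hil S (insert C G) A) (h₂ : Hil S (insert (neg C) G) A) :
    Hil S G A :=
  .mp h₂.deduction (.mp h₁.deduction (taut fun _ h₁ h₂ => _root_.by_contra fun h =>
    h (h₂ fun hc => h (h₁ hc))))

theorem and_intro (h₁ : Hil S G A) (h₂ : Hil S G B) : Hil S G (Fm.and A B) :=
  .mp h₂ (.mp h₁ (taut fun _ h₁ h₂ h => h h₁ h₂))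

theorem and_left (h : Hil S G (Fm.and A B)) : Hil S G A :=
  .mp h (taut fun _ hv => _root_.by_contra fun h => hv fun hA => (h hA).elim)

theorem and_right (h : Hil S G (Fm.and A B)) : Hil S G B :=
  .mp h (taut fun _ hv => _root_.by_contra fun h => hv fun _ => h)

theorem boxp_box (h : Hil S G (boxp A)) : Hil S G (box A) :=
  (mp h (.ax (.unfold A))).and_left

theorem boxp_box_boxp (h : Hil S G (boxp A)) : Hil S G (box (boxp A)) :=
  (mp h (.ax (.unfold A))).and_right

/-- A formula derivable from formulas that are necessary under `G` is necessary under `G`. -/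
theorem box_of {X : Set Fm} (h : Hil S X A) (hX : ∀ B ∈ X, Hil S G (box B)) :
    Hil S G (box A) := by
  induction h with
  | asm h => exact hX _ h
  | ax h => exact (nec (.ax h)).boxp_box
  | mp _ _ ih₁ ih₂ => exact .mp (ih₁ hX) (.mp (ih₂ hX) (.ax (.boxK _ _)))
  | nec h _ => exact (nec h).boxp_box_boxp

theorem boxp_mp (h₁ : Hil S G (boxp A)) (h₂ : Hil S G (boxp (imp A B))) : Hil S G (boxp B) :=
  .mp h₁ (.mp h₂ (.ax (.boxpK _ _)))

theorem boxp_ind (h₁ : Hil S G (box A)) (h₂ : Hil S G (boxp (imp A (box A)))) :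
    Hil S G (boxp A) :=
  .mp (and_intro h₁ h₂) (.ax (.ind _))

end Hil

/-- Every finite multiset of formulas has a conjunction. -/
theorem exists_conj (S : Set Fm) (m : Multiset Fm) :
    ∃ θ : Fm, (∀ G : Set Fm, (∀ B ∈ m, Hil S G B) → Hil S G θ) ∧
      ∀ B ∈ m, ∀ G : Set Fm, θ ∈ G → Hil S G B := by
  induction m using Multiset.induction_on with
  | empty => exact ⟨imp bot bot, fun G _ => .taut fun v hv => hv, by simp⟩
  | cons C m ih =>
    obtain ⟨θ, h₁, h₂⟩ := ih
    refine ⟨Fm.and C θ, fun G h => ?_, fun B hB G hG => ?_⟩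
    · exact (h C (by simp)).and_intro (h₁ G fun B hB => h B (by simp [hB]))
    · rcases Multiset.mem_cons.1 hB with rfl | hB
      · exact (Hil.asm hG).and_left
      · exact (Hil.asm hG).and_right.trans (h₂ B hB _ (Set.mem_insert _ _))

/-- Every finite set of finite multisets of formulas has a disjunction of conjunctions. -/
theorem exists_disj (S : Set Fm) {T : Set (Multiset Fm)} (hT : T.Finite) :
    ∃ θ : Fm, (∀ m ∈ T, ∀ G : Set Fm, (∀ B ∈ m, Hil S G B) → Hil S G θ) ∧
      ∀ (G : Set Fm) (C : Fm), (∀ m ∈ T, Hil S ({B | B ∈ m} ∪ G) C) → Hil S (insert θ G) C := by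
  induction T, hT using Set.Finite.induction_on with
  | empty => exact ⟨bot, by simp, fun G C _ => (Hil.asm (Set.mem_insert _ _)).exfalso⟩
  | @insert m T _ _ ih =>
    obtain ⟨θ, h₁, h₂⟩ := ih
    obtain ⟨η, h₃, h₄⟩ := exists_conj S m
    refine ⟨imp (neg η) θ, ?_, fun G C h => ?_⟩
    · rintro k (rfl | hk) G hG
      · exact .mp (h₃ G hG) (.taut fun v hv hn => (hn hv).elim)
      · exact .mp (h₁ k hk G hG) (.taut fun v hv _ => hv)
    · refine Hil.cases_neg η ((h m (.inl rfl)).subst ?_)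
        ((h₂ G C fun k hk => h k (.inr hk)).subst ?_)
      · rintro B (hB | hB)
        · exact h₄ B hB _ (Set.mem_insert _ _)
        · exact .asm (by simp [hB])
      · rintro B (rfl | hB)
        · exact .mp (.asm (Set.mem_insert _ _)) (.asm (by simp))
        · exact .asm (by simp [hB])

/-! ### Kripke semantics -/

/-- Truth of formulas at the worlds of a Kripke model. -/
def Sat {W : Type} (R : W → W → Prop) (V : W → ℕ → Prop) : W → Fm → Prop
  | w, var n => V w n
  | _, bot => False
  | w, imp A B => Sat R V w A → Sat R V w B
  | w, box A => ∀ v, R w v → Sat R V v A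
  | w, boxp A => ∀ v, Relation.TransGen R w v → Sat R V v A

section Semantics

variable {W : Type} {R : W → W → Prop} {V : W → ℕ → Prop}

theorem eval_sat (w : W) (A : Fm) : eval (Sat R V w) A ↔ Sat R V w A := by
  induction A with
  | imp A B ihA ihB => simp only [eval, Sat, ihA, ihB]
  | var | bot | box | boxp => simp [eval, Sat]

theorem sat_and {w : W} {A B : Fm} :
    Sat R V w (Fm.and A B) ↔ Sat R V w A ∧ Sat R V w B := by
  simp [Fm.and, neg, Sat]

theorem KAx.sat {A : Fm} (h : KAx A) (w : W) : Sat R V w A := by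
  cases h with
  | taut A h => exact (eval_sat w A).1 (h _)
  | boxK A B => exact fun h₁ h₂ v hv => h₁ v hv (h₂ v hv)
  | boxpK A B => exact fun h₁ h₂ v hv => h₁ v hv (h₂ v hv)
  | unfold A =>
    exact fun h => sat_and.2 ⟨fun v hv => h v (.single hv), fun v hv u hu => h u (.head hv hu)⟩
  | ind A =>
    intro h v hv
    obtain ⟨h₁, h₂⟩ := sat_and.1 h
    induction hv with
    | single hv => exact h₁ _ hv
    | tail hu hv ih => exact h₂ _ hu ih _ hv

/-- Global assumptions are needed only at worlds strictly above `w`, since boxed leaves lie under a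
necessitation; transitivity of the closure carries this through nested necessitations. -/
theorem Hil.sound {S G : Set Fm} {A : Fm} (h : Hil S G A) :
    ∀ w : W, (∀ v, Relation.TransGen R w v → ∀ B ∈ S, Sat R V v B) → (∀ B ∈ G, Sat R V w B) →
      Sat R V w A := by
  induction h with
  | asm h => exact fun w _ hG => hG _ h
  | ax h => exact fun w _ _ => h.sat w
  | mp _ _ ih₁ ih₂ => exact fun w hS hG => ih₂ w hS hG (ih₁ w hS hG)
  | nec _ ih => exact fun w hS _ v hv => ih v (fun u hu => hS u (hv.trans hu)) (hS v hv)

end Semantics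

/-! ### One step of cut-free proof search -/

/-- Number of symbols of a formula. -/
def Fm.weight : Fm → ℕ
  | var _ => 1
  | bot => 1
  | imp A B => weight A + weight B + 1
  | box A => weight A + 1
  | boxp A => weight A + 1

theorem Fm.weight_pos (A : Fm) : 0 < A.weight := by cases A <;> simp [weight]

/-- Number of symbols of the antecedent and the succedent. -/
def Sequent.weight (s : Sequent) : ℕ := (s.ant.map Fm.weight).sum + (s.suc.map Fm.weight).sum

/-- Initial sequents and the rules for implication. -/
def Rule.IsProp : Rule → Prop
  | init => True
  | impL => True
  | impR => True
  | _ => False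

theorem RuleInst.weight_lt {r : Rule} {s : Sequent} {l : List Sequent} (h : RuleInst r s l)
    (hr : r.IsProp) : ∀ x ∈ l, x.weight < s.weight := by
  cases h with
  | initVar | initBot => simp
  | impL S G D A B =>
    simp only [List.mem_cons, List.not_mem_nil, or_false, forall_eq_or_imp, forall_eq]
    simp only [Sequent.weight, Multiset.map_add, Multiset.sum_add, Multiset.map_singleton,
      Multiset.sum_singleton, Fm.weight]
    omega
  | impR S G D A B =>
    simp only [List.mem_singleton, forall_eq]
    simp only [Sequent.weight, Multiset.map_add, Multiset.sum_add, Multiset.map_singleton,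
      Multiset.sum_singleton, Fm.weight]
    omega
  | box | boxp | cut => exact hr.elim

theorem RuleInst.ctx_eq {r : Rule} {s : Sequent} {l : List Sequent} (h : RuleInst r s l) :
    ∀ x ∈ l, x.ctx = s.ctx := by
  cases h <;> simp

/-- `s` is in `P`, or it is the conclusion of a cut-free rule instance with premises in `Y`,
where the premise of (Box) and the left premise of (Box⁺) are in `P`, and the principal formula
of (Box⁺) is `Box⁺ A`. -/
inductive Step (P Y : Set Sequent) (A : Fm) : Sequent → Prop
  | mem {s : Sequent} : s ∈ P → Step P Y A s
  | prop {r : Rule} {s : Sequent} {l : List Sequent} : r.IsProp → RuleInst r s l →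
      (∀ x ∈ l, x ∈ Y) → Step P Y A s
  | box {B : Fm} {s p : Sequent} : RuleInst (Rule.box B) s [p] → p ∈ P → Step P Y A s
  | boxp {s p q : Sequent} : RuleInst (Rule.boxp A) s [p, q] → p ∈ P → q ∈ Y → Step P Y A s

/-- Closure of `P` under regular reasoning with a fixed principal formula of (Box⁺). -/
def StepClosed (S : Set Fm) (P : Set Sequent) : Prop :=
  ∀ (Y : Set Sequent) (A : Fm), Y.Finite → (∀ s ∈ Y, s.ctx = S) → (∀ s ∈ Y, Step P Y A s) → Y ⊆ P

/-! ### Sequents refutable in the Hilbert calculus -/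

/-- The antecedent, the negated succedent and the formulas from `Q` are inconsistent. -/
def Refutes (Q : Set Fm) (s : Sequent) : Prop :=
  Hil s.ctx ({B | B ∈ s.ant} ∪ {B | ∃ C ∈ s.suc, B = neg C} ∪ Q) bot

theorem Refutes.mono {Q Q' : Set Fm} {s : Sequent} (h : Refutes Q s) (hQ : Q ⊆ Q') :
    Refutes Q' s :=
  h.weaken (Set.union_subset_union_right _ hQ)

theorem RuleInst.refutes {r : Rule} {s : Sequent} {l : List Sequent} (h : RuleInst r s l)
    (hr : r.IsProp) {Q : Set Fm} (hl : ∀ x ∈ l, Refutes Q x) : Refutes Q s := by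
  cases h with
  | initVar S G D p =>
    exact Hil.contra (A := var p) (.asm (by simp)) (.asm (by simp))
  | initBot S G D => exact .asm (by simp)
  | impL S G D A B =>
    have h₁ := hl ⟨S, G + {B}, D⟩ (by simp)
    have h₂ := hl ⟨S, G, {A} + D⟩ (by simp)
    simp only [Refutes] at h₁ h₂ ⊢
    refine Hil.cases_neg A (.trans (A := B) ?_ (h₁.weaken ?_)) (h₂.weaken ?_)
    · exact .mp (.asm (A := A) (by simp)) (.asm (by simp))
    · intro C; simp; grind
    · intro C; simp; grind
  | impR S G D A B =>
    have h₁ := hl ⟨S, G + {A}, {B} + D⟩ (by simp)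
    simp only [Refutes] at h₁ ⊢
    refine Hil.contra (A := imp A B) (Hil.deduction (Hil.by_contra (h₁.weaken ?_))) (.asm ?_)
    · intro C; simp; grind
    · simp
  | box | boxp | cut => exact hr.elim

theorem RuleInst.hil_box {B : Fm} {s p : Sequent} (h : RuleInst (Rule.box B) s [p]) :
    p.suc = {B} ∧ Fm.box B ∈ s.suc ∧ ∀ C ∈ p.ant, Hil s.ctx {D | D ∈ s.ant} (Fm.box C) := by
  cases h with
  | box S S₀ hS L P F R A =>
    refine ⟨rfl, by simp, fun C hC => ?_⟩
    simp only [Multiset.mem_add, Multiset.mem_map] at hC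
    rcases hC with ((hC | hC) | hC) | ⟨D, hD, rfl⟩
    · exact (Hil.nec (.asm (hS hC))).boxp_box
    · exact .asm (by simp [hC])
    · exact (Hil.asm (by simp [hC])).boxp_box
    · exact (Hil.asm (by simp [hD])).boxp_box_boxp

theorem RuleInst.hil_boxp {A : Fm} {s p q : Sequent} (h : RuleInst (Rule.boxp A) s [p, q]) :
    p.suc = {A} ∧ q.suc = {Fm.boxp A} ∧ q.ant = p.ant ∧ Fm.boxp A ∈ s.suc ∧
      ∀ C ∈ p.ant, Hil s.ctx {D | D ∈ s.ant} (Fm.box C) := by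
  cases h with
  | boxp S S₀ hS L P F R A =>
    exact ⟨rfl, rfl, rfl, by simp, (RuleInst.box S S₀ hS L P F {Fm.box A} A).hil_box.2.2⟩

/-- Induction on weight handles the implication rules; (□) relies on a premise already refutable.
Only (□⁺) may return to `Y` without a decrease, so it is left to `hQ`. The extra formulas `Q` allow
two passes: one under the assumption ¬□θ, and one without it. -/
theorem Refutes.of_step {Y : Set Sequent} {A : Fm} {Q : Set Fm}
    (hY : ∀ s ∈ Y, Step {s | Refutes ∅ s} Y A s)
    (hQ : ∀ s ∈ Y, ∀ p q, RuleInst (Rule.boxp A) s [p, q] → Refutes ∅ p → q ∈ Y → Refutes Q s) :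
    ∀ s ∈ Y, Refutes Q s := by
  intro s hs
  induction hn : s.weight using Nat.strong_induction_on generalizing s with
  | _ n ih =>
    subst hn
    cases hY s hs with
    | mem h => exact h.mono (Set.empty_subset _)
    | prop hr h hl => exact h.refutes hr fun x hx => ih _ (h.weight_lt hr x hx) x (hl x hx) rfl
    | @box B s p h hp =>
      obtain ⟨h₁, h₂, h₃⟩ := h.hil_box
      have hc := h.ctx_eq p (by simp)
      simp only [Set.mem_ofPred_eq, Refutes, h₁, hc] at hp
      refine Hil.contra (A := Fm.box B) ((Hil.box_of (X := {C | C ∈ p.ant}) ?_ h₃).weaken ?_)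
        (.asm (.inl (.inr ⟨_, h₂, rfl⟩)))
      · exact Hil.by_contra (hp.weaken fun C => by simp)
      · exact fun C hC => .inl (.inl hC)
    | boxp h hp hq => exact hQ s hs _ _ h hp hq

/-- Let θ be the disjunction of the antecedents of the (□⁺) premises used in `Y`. Left premises give
θ ⊢ A; right premises lie in `Y` and give θ ⊢ □θ ∨ □⁺A. Hence A ∧ (θ ∨ □⁺A) is preserved by □, and
the induction axiom derives □⁺A wherever □θ holds, which includes every conclusion of (□⁺) in `Y`.
-/
theorem stepClosed_refutes (S : Set Fm) : StepClosed S {s | Refutes ∅ s} := by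
  intro Y A hfin hctx hY
  obtain ⟨θ, h₁, h₂⟩ := exists_disj S (T := {m | ∃ s ∈ Y, ∃ p q, RuleInst (Rule.boxp A) s [p, q] ∧
    Refutes ∅ p ∧ q ∈ Y ∧ m = p.ant}) (by
      -- Both premises of (□⁺) have the same antecedent, so finitely many right premises in `Y`
      -- bound the antecedents of the left ones too.
      refine (hfin.image Sequent.ant).subset ?_
      rintro m ⟨s, hs, p, q, h, hp, hq, rfl⟩
      exact ⟨q, hq, h.hil_boxp.2.2.1⟩)
  have box_θ : ∀ s ∈ Y, ∀ p q, RuleInst (Rule.boxp A) s [p, q] → Refutes ∅ p → q ∈ Y →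
      Hil S {D | D ∈ s.ant} (box θ) := by
    intro s hs p q h hp hq
    have h₃ := h.hil_boxp.2.2.2.2
    rw [hctx s hs] at h₃
    exact Hil.box_of (X := {C | C ∈ p.ant})
      (h₁ _ ⟨s, hs, p, q, h, hp, hq, rfl⟩ _ fun B hB => .asm hB) h₃
  -- First pass: under ¬□θ every application of (□⁺) is contradictory at once, so no induction axiom
  -- is needed yet.
  have step : ∀ s ∈ Y, Refutes {neg (box θ)} s := by
    refine Refutes.of_step hY fun s hs p q h hp hq => ?_
    have := box_θ s hs p q h hp hq
    rw [← hctx s hs] at this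
    exact Hil.contra (this.weaken fun C hC => .inl (.inl hC)) (.asm (.inr rfl))
  have hA : Hil S {θ} A := by
    rw [← insert_empty_eq θ]
    refine h₂ _ _ ?_
    rintro _ ⟨s, hs, p, q, h, hp, hq, rfl⟩
    have hc := h.ctx_eq p (by simp)
    simp only [Refutes, h.hil_boxp.1, hc, hctx s hs] at hp
    exact Hil.by_contra (hp.weaken fun C => by simp)
  have hθ : Hil S {θ, neg (boxp A), neg (box θ)} bot := by
    refine h₂ _ _ ?_
    rintro _ ⟨s, hs, p, q, h, hp, hq, rfl⟩
    have := step q hq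
    simp only [Refutes, h.hil_boxp.2.1, h.hil_boxp.2.2.1, hctx q hq] at this
    exact this.weaken fun C => by simp; tauto
  -- θ alone need not imply □θ: the alternative □⁺A is added as a second disjunct, written as an
  -- implication from ¬θ, and it is itself preserved by □.
  set B := Fm.and A (imp (neg θ) (boxp A)) with hB
  have hθB : Hil S {θ} B :=
    hA.and_intro (.mp (.asm rfl) (.taut fun v h₁ h₂ => (h₂ h₁).elim))
  have hpB : Hil S {A, boxp A} B :=
    Hil.and_intro (.asm (by simp)) (.mp (.asm (by simp)) (.taut fun v h₁ _ => h₁))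
  have hBB : ∀ G, Hil S G (imp B (box B)) := by
    intro G
    refine Hil.deduction (Hil.cases_neg (boxp A) ?_ ?_)
    · refine Hil.box_of hpB ?_
      rintro C (rfl | rfl)
      · exact (Hil.asm (Set.mem_insert _ _)).boxp_box
      · exact (Hil.asm (Set.mem_insert _ _)).boxp_box_boxp
    · refine Hil.cases_neg θ (Hil.cases_neg (box θ) ?_ ?_) ?_
      · exact Hil.box_of hθB fun C hC => .asm (by simp [Set.mem_singleton_iff.1 hC])
      · exact (hθ.weaken fun C => by simp; tauto).exfalso
      · refine Hil.contra (A := boxp A) (.mp (.asm (Set.mem_insert _ _)) ?_) (.asm (by simp))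
        exact Hil.and_right (A := A) (.asm (by simp [hB]))
  refine Refutes.of_step hY fun s hs p q h hp hq => ?_
  have hb : Hil S {D | D ∈ s.ant} (box B) :=
    Hil.box_of hθB fun C hC => by rw [Set.mem_singleton_iff.1 hC]; exact box_θ s hs p q h hp hq
  have hbp : Hil S {D | D ∈ s.ant} (boxp A) :=
    (hb.boxp_ind (.nec (hBB _))).boxp_mp (.nec (Hil.deduction (Hil.and_left (.asm (by
      exact Set.mem_insert _ _)))))
  rw [← hctx s hs] at hbp
  exact Hil.contra (hbp.weaken fun C hC => .inl (.inl hC))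
    (.asm (.inl (.inr ⟨_, h.hil_boxp.2.2.2.1, rfl⟩)))

/-! ### The rule applied at a node is unique -/

/-- Features of the premises that separate the rules from each other. -/
def Rule.Shape (s : Sequent) (l : List Sequent) : Rule → Prop
  | init => l = []
  | impL => ∃ a b, l = [a, b] ∧ a.suc.card = s.suc.card ∧ b.suc.card = s.suc.card + 1
  | impR => ∃ a, l = [a] ∧ a.suc.card = s.suc.card ∧ ∃ A B, imp A B ∈ s.suc
  | box A => ∃ a, l = [a] ∧ a.suc = {A} ∧ Fm.box A ∈ s.suc
  | boxp A => ∃ a b, l = [a, b] ∧ a.suc = {A} ∧ b.suc = {Fm.boxp A}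
  | cut => ∃ a b, l = [a, b] ∧ a.suc.card = s.suc.card + 1 ∧ b.suc.card = s.suc.card

theorem RuleInst.shape {r : Rule} {s : Sequent} {l : List Sequent} (h : RuleInst r s l) :
    r.Shape s l := by
  cases h with
  | initVar | initBot => rfl
  | impL => exact ⟨_, _, rfl, by simp⟩
  | impR S G D A B => exact ⟨_, rfl, by simp, A, B, by simp⟩
  | box => exact ⟨_, rfl, rfl, by simp⟩
  | boxp => exact ⟨_, _, rfl, rfl, rfl⟩
  | cut => exact ⟨_, _, rfl, by simp⟩

theorem Rule.Shape.unique {r r' : Rule} {s : Sequent} {l : List Sequent} (h : r.Shape s l)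
    (h' : r'.Shape s l) : r = r' := by
  -- (□) and (→_R) both have one premise; equal succedent sizes would force a singleton succedent
  -- containing both an implication and a boxed formula. The other pairs are separated by the number
  -- of premises or by succedent sizes.
  have key : ∀ {a : Sequent} {A B C : Fm}, a.suc = {A} → a.suc.card = s.suc.card →
      imp B C ∈ s.suc → Fm.box A ∈ s.suc → False := by
    intro a A B C h₁ h₂ h₃ h₄
    rw [h₁, Multiset.card_singleton] at h₂
    obtain ⟨D, hD⟩ := Multiset.card_eq_one.1 h₂.symm
    rw [hD, Multiset.mem_singleton] at h₃ h₄
    exact absurd (h₃.trans h₄.symm) (by simp)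
  cases r <;> cases r' <;> simp only [Shape] at h h' <;> try rfl
  all_goals grind [Multiset.singleton_inj, Multiset.card_singleton]

/-- The branch condition speaks of every rule that a node can be read as applying; uniqueness lets
it be checked on the chosen rule alone. -/
theorem RuleInst.unique {r r' : Rule} {s : Sequent} {l : List Sequent} (h : RuleInst r s l)
    (h' : RuleInst r' s l) : r = r' :=
  h.shape.unique h'.shape

namespace SeqTree

theorem AppliesAt.unique {t : SeqTree} {a : List ℕ} {r r' : Rule} (h : t.AppliesAt a r)
    (h' : t.AppliesAt a r') : r = r' := by
  obtain ⟨s, l, hs, hr, hl⟩ := h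
  obtain ⟨s', l', hs', hr', hl'⟩ := h'
  obtain rfl : s = s' := Option.some.inj (hs.symm.trans hs')
  obtain rfl : l = l' := List.ext_getElem? fun i => (hl i).symm.trans (hl' i)
  exact hr.unique hr'

/-! ### Branches and subtrees -/

theorem branchNode_zero (b : ℕ → ℕ) : branchNode b 0 = [] := rfl

theorem branchNode_succ (b : ℕ → ℕ) (n : ℕ) : branchNode b (n + 1) = branchNode b n ++ [b n] := by
  simp [branchNode, List.range_succ]

theorem branchNode_add (b : ℕ → ℕ) (n m : ℕ) :
    branchNode b (n + m) = branchNode b n ++ branchNode (fun k => b (n + k)) m := by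
  induction m with
  | zero => simp [branchNode_zero]
  | succ m ih => rw [← add_assoc, branchNode_succ, ih, branchNode_succ, List.append_assoc]

theorem subtree_apply (t : SeqTree) (a c : List ℕ) : t.subtree a c = t (a ++ c) := rfl

theorem subtree_appliesAt {t : SeqTree} {a c : List ℕ} {r : Rule} :
    (t.subtree a).AppliesAt c r ↔ t.AppliesAt (a ++ c) r := by
  simp [AppliesAt, subtree]

theorem subtree_subtree (t : SeqTree) (a c : List ℕ) :
    (t.subtree a).subtree c = t.subtree (a ++ c) := by
  funext d
  simp [subtree]

theorem goodBranch_of_subtree {t : SeqTree} {b : ℕ → ℕ} (n : ℕ)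
    (h : (t.subtree (branchNode b n)).GoodBranch fun k => b (n + k)) : t.GoodBranch b := by
  obtain ⟨N, A, h₁, h₂, h₃, h₄⟩ := h
  simp only [subtree_appliesAt, ← branchNode_add] at h₁ h₂ h₃ h₄
  refine ⟨n + N, A, fun m hm => ?_, fun m => ?_, fun m hm => ?_, fun m hm => ?_⟩
  · obtain ⟨k, rfl⟩ := Nat.exists_eq_add_of_le (le_of_add_le_left hm)
    exact h₁ k (by omega)
  · obtain ⟨k, hk, hN, hB, hb⟩ := h₂ m
    exact ⟨n + k, by omega, by omega, hB, hb⟩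
  · obtain ⟨k, rfl⟩ := Nat.exists_eq_add_of_le (le_of_add_le_left hm)
    exact h₃ k (by omega)
  · obtain ⟨k, rfl⟩ := Nat.exists_eq_add_of_le (le_of_add_le_left hm)
    exact h₄ k (by omega)

/-! ### Gluing trees along a finite graph of sequents -/

open Classical in
/-- The unfolding of the graph with edges from `s` to the members of `prem s`, where
the sequents from `P` are replaced by the trees assigned to them by `base`. -/
noncomputable def unfold (P : Set Sequent) (base : Sequent → SeqTree)
    (prem : Sequent → List Sequent) : List ℕ → Sequent → Option Sequent
  | [], s => some s
  | i :: a, s =>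
    if s ∈ P then base s (i :: a) else ((prem s)[i]?).bind (unfold P base prem a)

section Unfold

variable {P : Set Sequent} {base : Sequent → SeqTree} {prem : Sequent → List Sequent}

/-- The unfolding that starts from the sequent `s`. -/
noncomputable def unfoldTree (P : Set Sequent) (base : Sequent → SeqTree)
    (prem : Sequent → List Sequent) (s : Sequent) : SeqTree :=
  fun a => unfold P base prem a s

theorem unfoldTree_nil (s : Sequent) : unfoldTree P base prem s [] = some s := rfl

theorem unfoldTree_of_mem {s : Sequent} (hs : s ∈ P) (hb : base s [] = some s) :
    unfoldTree P base prem s = base s := by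
  funext a
  cases a with
  | nil => exact hb.symm
  | cons i a => simp [unfoldTree, unfold, hs]

theorem unfoldTree_cons {s : Sequent} (hs : s ∉ P) (i : ℕ) (a : List ℕ) :
    unfoldTree P base prem s (i :: a) =
      ((prem s)[i]?).bind fun x => unfoldTree P base prem x a := by
  simp only [unfoldTree, unfold, hs, if_false]

theorem unfoldTree_subtree {s x : Sequent} (hs : s ∉ P) {i : ℕ} (hx : (prem s)[i]? = some x) :
    (unfoldTree P base prem s).subtree [i] = unfoldTree P base prem x := by
  funext a
  simp [subtree, unfoldTree_cons hs, hx]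

theorem unfoldTree_appliesAt {s : Sequent} (hs : s ∉ P) {r : Rule} :
    (unfoldTree P base prem s).AppliesAt [] r ↔ RuleInst r s (prem s) := by
  have h : ∀ i : ℕ, unfoldTree P base prem s ([] ++ [i]) = (prem s)[i]? := by
    intro i
    simp only [List.nil_append, unfoldTree_cons hs, unfoldTree_nil]
    exact Option.bind_fun_some _
  constructor
  · rintro ⟨s', l, h₁, h₂, h₃⟩
    obtain rfl : s = s' := Option.some.inj h₁
    obtain rfl : prem s = l := List.ext_getElem? fun i => (h i).symm.trans (h₃ i)
    exact h₂
  · exact fun hr => ⟨s, prem s, rfl, hr, h⟩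

/-- Every node of the unfolding is the root of an unfolding or lies in a tree from `base`. -/
theorem unfoldTree_node {Z : Set Sequent} (hb : ∀ s ∈ P, base s [] = some s)
    (hZ : ∀ s ∈ Z, s ∉ P → ∀ x ∈ prem s, x ∈ Z) (a : List ℕ) :
    ∀ s ∈ Z, (unfoldTree P base prem s).IsNode a →
      (∃ x ∈ Z, x ∉ P ∧ (unfoldTree P base prem s).subtree a = unfoldTree P base prem x) ∨
      ∃ x ∈ Z, x ∈ P ∧ ∃ c, (base x).IsNode c ∧
        (unfoldTree P base prem s).subtree a = (base x).subtree c := by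
  induction a with
  | nil =>
    intro s hs _
    by_cases hP : s ∈ P
    · exact .inr ⟨s, hs, hP, [], by simp [IsNode, hb s hP], by rw [unfoldTree_of_mem hP (hb s hP)]⟩
    · exact .inl ⟨s, hs, hP, rfl⟩
  | cons i a ih =>
    intro s hs ha
    by_cases hP : s ∈ P
    · rw [unfoldTree_of_mem hP (hb s hP)] at ha ⊢
      exact .inr ⟨s, hs, hP, i :: a, ha, rfl⟩
    · rw [IsNode, unfoldTree_cons hP] at ha
      cases hx : (prem s)[i]? with
      | none => simp [hx] at ha
      | some x =>
        rw [hx, Option.bind_some] at ha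
        have := ih x (hZ s hs hP x (List.mem_of_getElem? hx)) ha
        rwa [← unfoldTree_subtree hP hx, subtree_subtree] at this

theorem unfoldTree_closed (hb : ∀ s ∈ P, base s [] = some s)
    (hcl : ∀ s ∈ P, ∀ (a : List ℕ) (i : ℕ), (base s).IsNode (a ++ [i]) → (base s).IsNode a)
    (s : Sequent) (a : List ℕ) (i : ℕ) (h : (unfoldTree P base prem s).IsNode (a ++ [i])) :
    (unfoldTree P base prem s).IsNode a := by
  induction a generalizing s with
  | nil => rfl
  | cons j a ih =>
    by_cases hP : s ∈ P
    · rw [unfoldTree_of_mem hP (hb s hP)] at h ⊢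
      exact hcl s hP _ i h
    · rw [IsNode, List.cons_append, unfoldTree_cons hP] at h
      rw [IsNode, unfoldTree_cons hP]
      cases hx : (prem s)[j]? with
      | none => simp [hx] at h
      | some x =>
        rw [hx, Option.bind_some] at h
        exact ih x h

/-- An infinite branch of the unfolding enters a tree from `base` or stays outside of `P`. -/
theorem unfoldTree_branch {Z : Set Sequent} (hb : ∀ s ∈ P, base s [] = some s)
    (hZ : ∀ s ∈ Z, s ∉ P → ∀ x ∈ prem s, x ∈ Z) (s : Sequent) (hs : s ∈ Z) {b : ℕ → ℕ}
    (h : (unfoldTree P base prem s).IsInfiniteBranch b) :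
    (∃ n, ∃ x ∈ P, (unfoldTree P base prem s).subtree (branchNode b n) = base x) ∨
      ∀ n, ∃ x ∈ Z, x ∉ P ∧
        (unfoldTree P base prem s).subtree (branchNode b n) = unfoldTree P base prem x := by
  refine or_iff_not_imp_left.2 fun hne n => ?_
  have key : ∀ n, ∀ x ∈ Z, (unfoldTree P base prem s).subtree (branchNode b n) =
      unfoldTree P base prem x → x ∉ P := fun n x _ h hP =>
    hne ⟨n, x, hP, by rw [h, unfoldTree_of_mem hP (hb x hP)]⟩
  induction n with
  | zero => exact ⟨s, hs, key 0 s hs rfl, rfl⟩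
  | succ n ih =>
    obtain ⟨x, hx, hP, hsub⟩ := ih
    have hnode := h (n + 1)
    rw [branchNode_succ, IsNode, ← subtree_apply (unfoldTree P base prem s), hsub, unfoldTree_cons hP] at hnode
    cases hy : (prem x)[b n]? with
    | none => simp [hy] at hnode
    | some y =>
      have hyZ := hZ x hx hP y (List.mem_of_getElem? hy)
      have : (unfoldTree P base prem s).subtree (branchNode b (n + 1)) =
          unfoldTree P base prem y := by
        rw [branchNode_succ, ← subtree_subtree, hsub, unfoldTree_subtree hP hy]
      exact ⟨y, hyZ, key _ y hyZ this, this⟩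

end Unfold

end SeqTree

open SeqTree

/-- If a step closes `s` without membership in `P`, it is given by a rule instance. -/
theorem Step.exists_ruleInst {P Y : Set Sequent} {A : Fm} {s : Sequent} (h : Step P Y A s)
    (hs : s ∉ P) : ∃ (r : Rule) (l : List Sequent), RuleInst r s l ∧ (∀ x ∈ l, x ∈ Y ∪ P) ∧
      r ≠ Rule.cut ∧ (r.IsProp ∨ (∃ B, r = Rule.box B ∧ ∀ x ∈ l, x ∈ P) ∨
        (r = Rule.boxp A ∧ ∀ x, l[0]? = some x → x ∈ P)) := by
  cases h with
  | mem h => exact (hs h).elim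
  | @prop r _ l hr h hl => exact ⟨r, l, h, fun x hx => .inl (hl x hx), by rintro rfl; exact hr, .inl hr⟩
  | box h hp =>
    exact ⟨_, _, h, by simp [hp], by simp, .inr (.inl ⟨_, rfl, by simpa using hp⟩)⟩
  | boxp h hp hq =>
    exact ⟨_, _, h, by simp [hp, hq], by simp, .inr (.inr ⟨rfl, by simp [hp]⟩)⟩

/-- One rule instance is fixed for each member of `Y` outside `P`, and the resulting finite graph is
unfolded, with given proofs grafted at sequents of `P`. A branch that never enters `P` avoids (□)
and left premises of (□⁺), and implication rules alone cannot continue forever, so it passes right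
premises with principal formula □⁺A infinitely often. -/
theorem stepClosed_regCutFree (S : Set Fm) : StepClosed S {s | RegCutFreeProvable s} := by
  classical
  intro Y A hfin _ hY
  set P : Set Sequent := {s | RegCutFreeProvable s} with hPdef
  have hPr : ∀ s, ∃ t : SeqTree, s ∈ P → t.IsInfProof ∧ t [] = some s ∧ t.Regular ∧ t.CutFree :=
    fun s => by
      by_cases hs : s ∈ P
      · obtain ⟨t, ht⟩ := hs
        exact ⟨t, fun _ => ht⟩
      · exact ⟨fun _ => none, fun h => (hs h).elim⟩
  choose base hbase using hPr
  have hpr : ∀ s, ∃ (r : Rule) (l : List Sequent), s ∈ Y → s ∉ P → RuleInst r s l ∧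
      (∀ x ∈ l, x ∈ Y ∪ P) ∧ r ≠ Rule.cut ∧ (r.IsProp ∨ (∃ B, r = Rule.box B ∧ ∀ x ∈ l, x ∈ P) ∨
        (r = Rule.boxp A ∧ ∀ x, l[0]? = some x → x ∈ P)) := fun s => by
    by_cases hs : s ∈ Y ∧ s ∉ P
    · obtain ⟨r, l, h⟩ := (hY s hs.1).exists_ruleInst hs.2
      exact ⟨r, l, fun _ _ => h⟩
    · exact ⟨Rule.init, [], fun h₁ h₂ => (hs ⟨h₁, h₂⟩).elim⟩
  choose rule prem hprem using hpr
  set T := unfoldTree P base prem with hT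
  -- All sequents reachable before or on entering `P`; finite, which gives regularity.
  set Z : Set Sequent := Y ∪ ⋃ s ∈ Y, {x | x ∈ prem s ∧ x ∈ P} with hZdef
  have hZfin : Z.Finite := hfin.union (hfin.biUnion fun s _ =>
    (prem s).finite_toSet.subset fun x hx => hx.1)
  have hZY : ∀ s ∈ Z, s ∉ P → s ∈ Y := by
    rintro s (hs | hs) hP
    · exact hs
    · simp only [Set.mem_iUnion] at hs
      obtain ⟨_, _, _, h⟩ := hs
      exact (hP h).elim
  have hroot : ∀ s ∈ P, base s [] = some s := fun s hs => (hbase s hs).2.1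
  have hZ : ∀ s ∈ Z, s ∉ P → ∀ x ∈ prem s, x ∈ Z := by
    intro s hs hP x hx
    have hsY := hZY s hs hP
    rcases (hprem s hsY hP).2.1 x hx with h | h
    · exact .inl h
    · exact .inr (Set.mem_biUnion hsY ⟨hx, h⟩)
  have hnode := unfoldTree_node (base := base) hroot hZ
  rw [← hT] at hnode
  intro s hsY
  have hsZ : s ∈ Z := .inl hsY
  have happ : ∀ x ∈ Z, x ∉ P → (T x).AppliesAt [] (rule x) := fun x hx hP =>
    (unfoldTree_appliesAt hP).2 (hprem x (hZY x hx hP) hP).1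
  refine ⟨T s, ⟨rfl, ?_, ?_, ?_⟩, rfl, ?_, ?_⟩
  · exact unfoldTree_closed hroot (fun x hx => (hbase x hx).1.closed) s
  · intro a ha
    rcases hnode a s hsZ ha with ⟨x, hx, hP, h⟩ | ⟨x, hx, hP, c, hc, h⟩
    · refine ⟨rule x, ?_⟩
      have := happ x hx hP
      rwa [← h, subtree_appliesAt, List.append_nil] at this
    · obtain ⟨r, hr⟩ := (hbase x hP).1.rules c hc
      refine ⟨r, ?_⟩
      rw [← List.append_nil c, ← subtree_appliesAt, ← h, subtree_appliesAt, List.append_nil] at hr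
      exact hr
  · intro b hb
    rcases unfoldTree_branch hroot hZ s hsZ hb with ⟨n, x, hx, h⟩ | h
    · refine goodBranch_of_subtree n ?_
      rw [h]
      refine (hbase x hx).1.branches _ fun k => ?_
      have := hb (n + k)
      rwa [branchNode_add, IsNode, ← subtree_apply (T s), h] at this
    · choose x hxZ hxP hx using h
      have hval : ∀ n, T s (branchNode b n) = some (x n) := fun n => by
        have := congrFun (hx n) []
        simpa [subtree, unfoldTree_nil] using this
      have hrule : ∀ n, (T s).AppliesAt (branchNode b n) (rule (x n)) := fun n => by
        have := happ (x n) (hxZ n) (hxP n)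
        rwa [hT, ← hx n, subtree_appliesAt, List.append_nil] at this
      have hnext : ∀ n, (prem (x n))[b n]? = some (x (n + 1)) := fun n => by
        have := hval (n + 1)
        rw [branchNode_succ, ← subtree_apply (T s), hT, hx n, unfoldTree_cons (hxP n)] at this
        simpa [unfoldTree_nil] using this
      have hspec := fun n => hprem (x n) (hZY _ (hxZ n) (hxP n)) (hxP n)
      have hbox : ∀ n B, rule (x n) ≠ Rule.box B := by
        intro n B h
        rcases (hspec n).2.2.2 with h' | ⟨_, _, h'⟩ | ⟨h', _⟩
        · rw [h] at h'
          exact h'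
        · exact hxP _ (h' _ (List.mem_of_getElem? (hnext n)))
        · simp [h] at h'
      have hboxp : ∀ n B, rule (x n) = Rule.boxp B → B = A ∧ b n = 1 := by
        intro n B h
        rcases (hspec n).2.2.2 with h' | ⟨_, h', _⟩ | ⟨h', h''⟩
        · rw [h] at h'
          exact h'.elim
        · simp [h] at h'
        · have hBA : B = A := by simpa [h] using h'
          have h0 : b n ≠ 0 := fun h0 => hxP _ (h'' _ (h0 ▸ hnext n))
          obtain ⟨p, q, hpq, _⟩ := h ▸ (hspec n).1.shape
          have := (List.getElem?_eq_some_iff.1 (hnext n)).1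
          simp [hpq] at this
          exact ⟨hBA, by omega⟩
      -- Without (□⁺) from height `m` on, each step is an implication rule and lowers the weight by
      -- at least one.
      have hinf : ∀ m, ∃ n ≥ m, rule (x n) = Rule.boxp A := by
        by_contra! hcon
        obtain ⟨m, hm⟩ := hcon
        have hdec : ∀ k, (x (m + k)).weight + k ≤ (x m).weight := by
          intro k
          induction k with
          | zero => simp
          | succ k ih =>
            have hp : (rule (x (m + k))).IsProp := by
              rcases (hspec (m + k)).2.2.2 with h | ⟨B, h, _⟩ | ⟨h, _⟩
              · exact h
              · exact (hbox _ B h).elim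
              · exact (hm _ (by omega) h).elim
            have := (hspec (m + k)).1.weight_lt hp _ (List.mem_of_getElem? (hnext (m + k)))
            rw [← add_assoc m k 1]
            omega
        have := hdec ((x m).weight + 1)
        omega
      refine ⟨0, A, fun n _ B h => (hboxp n B ((hrule n).unique h)).1, fun m => ?_,
        fun n _ B h => ?_, fun n _ B h => hbox n B ((hrule n).unique h)⟩
      · obtain ⟨n, hn, h⟩ := hinf m
        exact ⟨n, hn, Nat.zero_le n, ⟨A, h ▸ hrule n⟩, (hboxp n A h).2⟩
      · rw [(hboxp n B ((hrule n).unique h)).2]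
        exact one_ne_zero
  -- A subtree is either the unfolding from a member of `Z` or a subtree of one of the finitely many
  -- regular grafted proofs.
  · refine ((hZfin.image T).union (hZfin.biUnion (t := fun x => if x ∈ P then
      {u | ∃ c, (base x).IsNode c ∧ u = (base x).subtree c} else ∅) fun x _ => ?_)).subset ?_
    · split_ifs with hP
      · exact (hbase x hP).2.2.1
      · exact Set.finite_empty
    · rintro u ⟨a, ha, rfl⟩
      rcases hnode a s hsZ ha with ⟨x, hx, hP, h⟩ | ⟨x, hx, hP, c, hc, h⟩
      · exact .inl ⟨x, hx, h.symm⟩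
      · exact .inr (Set.mem_biUnion hx (by simp only [hP, if_true]; exact ⟨c, hc, h⟩))
  · intro a hcut
    have ha : (T s).IsNode a := by
      obtain ⟨s', _, h, _⟩ := hcut
      simp [IsNode, h]
    rcases hnode a s hsZ ha with ⟨x, hx, hP, h⟩ | ⟨x, hx, hP, c, hc, h⟩
    · have := happ x hx hP
      rw [← h, subtree_appliesAt, List.append_nil] at this
      exact (hprem x (hZY x hx hP) hP).2.2.1 (this.unique hcut)
    · refine (hbase x hP).2.2.2 c ?_
      rw [← List.append_nil c, ← subtree_appliesAt, ← h, subtree_appliesAt, List.append_nil]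
      exact hcut

/-! ### Finite sets of formulas closed under subformulas -/

/-- Closure under immediate subformulas. -/
structure SubClosed (U : Finset Fm) : Prop where
  imp : ∀ {A B : Fm}, Fm.imp A B ∈ U → A ∈ U ∧ B ∈ U
  box : ∀ {A : Fm}, Fm.box A ∈ U → A ∈ U
  boxp : ∀ {A : Fm}, Fm.boxp A ∈ U → A ∈ U

section SubClosed

variable [DecidableEq Fm]

theorem SubClosed.union {U V : Finset Fm} (hU : SubClosed U) (hV : SubClosed V) :
    SubClosed (U ∪ V) := by
  constructor <;> intro A <;> simp only [Finset.mem_union]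
  · rintro B (h | h)
    · exact ⟨.inl (hU.imp h).1, .inl (hU.imp h).2⟩
    · exact ⟨.inr (hV.imp h).1, .inr (hV.imp h).2⟩
  · exact Or.imp hU.box hV.box
  · exact Or.imp hU.boxp hV.boxp

theorem SubClosed.insert {U : Finset Fm} (hU : SubClosed U) {A : Fm}
    (hi : ∀ B C, A = Fm.imp B C → B ∈ U ∧ C ∈ U) (hb : ∀ B, A = Fm.box B → B ∈ U)
    (hp : ∀ B, A = Fm.boxp B → B ∈ U) : SubClosed (insert A U) := by
  constructor <;> intro B <;> simp only [Finset.mem_insert]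
  · rintro C (h | h)
    · exact ⟨.inr (hi _ _ h.symm).1, .inr (hi _ _ h.symm).2⟩
    · exact ⟨.inr (hU.imp h).1, .inr (hU.imp h).2⟩
  · rintro (h | h)
    · exact .inr (hb _ h.symm)
    · exact .inr (hU.box h)
  · rintro (h | h)
    · exact .inr (hp _ h.symm)
    · exact .inr (hU.boxp h)

theorem exists_subClosed_mem (A : Fm) : ∃ U : Finset Fm, A ∈ U ∧ SubClosed U := by
  have h₀ : SubClosed ∅ := by constructor <;> simp
  induction A with
  | var n => exact ⟨_, Finset.mem_insert_self _ _, h₀.insert (by simp) (by simp) (by simp)⟩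
  | bot => exact ⟨_, Finset.mem_insert_self _ _, h₀.insert (by simp) (by simp) (by simp)⟩
  | imp A B ihA ihB =>
    obtain ⟨U, hA, hU⟩ := ihA
    obtain ⟨V, hB, hV⟩ := ihB
    exact ⟨_, Finset.mem_insert_self _ _,
      (hU.union hV).insert (by simp_all) (by simp) (by simp)⟩
  | box A ih | boxp A ih =>
    obtain ⟨U, hA, hU⟩ := ih
    exact ⟨_, Finset.mem_insert_self _ _, hU.insert (by simp) (by simp_all) (by simp_all)⟩

theorem exists_subClosed (F : Finset Fm) : ∃ U : Finset Fm, F ⊆ U ∧ SubClosed U := by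
  induction F using Finset.induction_on with
  | empty => exact ⟨∅, subset_rfl, by constructor <;> simp⟩
  | insert A F _ ih =>
    obtain ⟨U, hF, hU⟩ := ih
    obtain ⟨V, hA, hV⟩ := exists_subClosed_mem A
    refine ⟨V ∪ U, Finset.insert_subset (Finset.mem_union_left _ hA)
      (hF.trans Finset.subset_union_right), hV.union hU⟩

end SubClosed

/-! ### Canonical modal premises -/

section Canonical

variable [DecidableEq Fm]

/-- The formulas `B` with `Box B` in `G`. -/
def boxArgs (G : Multiset Fm) : Finset Fm :=
  (G.filterMap fun | box B => some B | _ => none).toFinset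

/-- The formulas `B` with `Box⁺ B` in `G`. -/
def boxpArgs (G : Multiset Fm) : Finset Fm :=
  (G.filterMap fun | boxp B => some B | _ => none).toFinset

theorem mem_boxArgs {G : Multiset Fm} {B : Fm} : B ∈ boxArgs G ↔ box B ∈ G := by
  simp only [boxArgs, Multiset.mem_toFinset, Multiset.mem_filterMap]
  constructor
  · rintro ⟨C, hC, h⟩
    cases C <;> simp_all
  · exact fun h => ⟨_, h, rfl⟩

theorem mem_boxpArgs {G : Multiset Fm} {B : Fm} : B ∈ boxpArgs G ↔ boxp B ∈ G := by
  simp only [boxpArgs, Multiset.mem_toFinset, Multiset.mem_filterMap]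
  constructor
  · rintro ⟨C, hC, h⟩
    cases C <;> simp_all
  · exact fun h => ⟨_, h, rfl⟩

/-- The antecedent of the largest premise of a modal rule without repetitions. -/
def modalAnt (F : Finset Fm) (G : Multiset Fm) : Multiset Fm :=
  F.val + (boxArgs G).val + (boxpArgs G).val + (boxpArgs G).val.map boxp

theorem mem_modalAnt {F : Finset Fm} {G : Multiset Fm} {C : Fm} : C ∈ modalAnt F G ↔
    C ∈ F ∨ box C ∈ G ∨ boxp C ∈ G ∨ ∃ B, boxp B ∈ G ∧ C = boxp B := by
  simp only [modalAnt, Multiset.mem_add, Finset.mem_val, mem_boxArgs, mem_boxpArgs,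
    Multiset.mem_map, or_assoc, eq_comm]

/-- One copy of each modal formula is kept and the repetitions go to the weakening part, so the
weight of canonical premises does not grow with multiplicities. -/
theorem exists_boxArgs_add (G : Multiset Fm) :
    ∃ F, G = F + (boxArgs G).val.map box + (boxpArgs G).val.map boxp := by
  have hle : (boxArgs G).val.map box + (boxpArgs G).val.map boxp ≤ G := by
    refine (Multiset.le_iff_subset ?_).2 ?_
    · refine Multiset.nodup_add.2 ⟨(boxArgs G).nodup.map fun _ _ h => by simpa using h,
        (boxpArgs G).nodup.map fun _ _ h => by simpa using h, ?_⟩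
      refine Multiset.disjoint_left.2 fun h₁ h₂ => ?_
      obtain ⟨A, _, rfl⟩ := Multiset.mem_map.1 h₁
      obtain ⟨B, _, h⟩ := Multiset.mem_map.1 h₂
      simp at h
    · intro C hC
      rcases Multiset.mem_add.1 hC with h | h <;> obtain ⟨A, hA, rfl⟩ := Multiset.mem_map.1 h
      · exact mem_boxArgs.1 hA
      · exact mem_boxpArgs.1 hA
  obtain ⟨F, hF⟩ := Multiset.le_iff_exists_add.1 hle
  exact ⟨F, by rw [add_assoc, add_comm, ← hF]⟩

theorem ruleInst_box {F : Finset Fm} {s : Sequent} (hF : (F : Set Fm) ⊆ s.ctx) {A : Fm}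
    (hA : box A ∈ s.suc) : RuleInst (Rule.box A) s [⟨s.ctx, modalAnt F s.ant, {A}⟩] := by
  obtain ⟨S, G, D⟩ := s
  obtain ⟨Φ, hΦ⟩ := exists_boxArgs_add G
  obtain ⟨D, rfl⟩ := Multiset.exists_cons_of_mem hA
  have := RuleInst.box S F hF (boxArgs G).val (boxpArgs G).val Φ D A
  rwa [← hΦ] at this

theorem ruleInst_boxp {F : Finset Fm} {s : Sequent} (hF : (F : Set Fm) ⊆ s.ctx) {A : Fm}
    (hA : boxp A ∈ s.suc) : RuleInst (Rule.boxp A) s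
      [⟨s.ctx, modalAnt F s.ant, {A}⟩, ⟨s.ctx, modalAnt F s.ant, {boxp A}⟩] := by
  obtain ⟨S, G, D⟩ := s
  obtain ⟨Φ, hΦ⟩ := exists_boxArgs_add G
  obtain ⟨D, rfl⟩ := Multiset.exists_cons_of_mem hA
  have := RuleInst.boxp S F hF (boxArgs G).val (boxpArgs G).val Φ D A
  rwa [← hΦ] at this

end Canonical

/-! ### Reduction by the rules for implication -/

/-- `x` is a premise of a rule for implication with conclusion `s`. -/
def PropStep (s x : Sequent) : Prop :=
  ∃ (r : Rule) (l : List Sequent), r.IsProp ∧ RuleInst r s l ∧ x ∈ l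

/-- No rule for implication has the conclusion `s`. -/
def Saturated (s : Sequent) : Prop := ∀ x, ¬ PropStep s x

theorem PropStep.ctx_eq {s x : Sequent} (h : PropStep s x) : x.ctx = s.ctx := by
  obtain ⟨r, l, _, h, hx⟩ := h
  exact h.ctx_eq x hx

theorem PropStep.weight_lt {s x : Sequent} (h : PropStep s x) : x.weight < s.weight := by
  obtain ⟨r, l, hr, h, hx⟩ := h
  exact h.weight_lt hr x hx

theorem Saturated.imp_notMem_ant {s : Sequent} (h : Saturated s) (A B : Fm) :
    imp A B ∉ s.ant := by
  intro hm
  obtain ⟨S, G, D⟩ := s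
  obtain ⟨G, rfl⟩ := Multiset.exists_cons_of_mem hm
  have := RuleInst.impL S G D A B
  rw [add_comm, Multiset.singleton_add] at this
  exact h _ ⟨Rule.impL, _, trivial, this, List.mem_cons_self⟩

theorem Saturated.imp_notMem_suc {s : Sequent} (h : Saturated s) (A B : Fm) :
    imp A B ∉ s.suc := by
  intro hm
  obtain ⟨S, G, D⟩ := s
  obtain ⟨D, rfl⟩ := Multiset.exists_cons_of_mem hm
  exact h _ ⟨Rule.impR, _, trivial, RuleInst.impR S G D A B, List.mem_cons_self⟩

theorem PropStep.ant {s x : Sequent} (h : PropStep s x) {C : Fm} (hC : C ∈ s.ant) :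
    C ∈ x.ant ∨ ∃ A B, C = imp A B ∧ (B ∈ x.ant ∨ A ∈ x.suc) := by
  obtain ⟨r, l, hr, h, hx⟩ := h
  cases h with
  | initVar | initBot => simp at hx
  | impL S G D A B =>
    simp only [List.mem_cons, List.not_mem_nil, or_false] at hx
    rcases Multiset.mem_add.1 hC with hC | hC
    · rcases hx with rfl | rfl <;> simp [hC]
    · obtain rfl := Multiset.mem_singleton.1 hC
      exact .inr ⟨A, B, rfl, by rcases hx with rfl | rfl <;> simp⟩
  | impR S G D A B =>
    obtain rfl := List.mem_singleton.1 hx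
    exact .inl (Multiset.mem_add.2 (.inl hC))
  | box | boxp | cut => exact hr.elim

theorem PropStep.suc {s x : Sequent} (h : PropStep s x) {C : Fm} (hC : C ∈ s.suc) :
    C ∈ x.suc ∨ ∃ A B, C = imp A B ∧ A ∈ x.ant ∧ B ∈ x.suc := by
  obtain ⟨r, l, hr, h, hx⟩ := h
  cases h with
  | initVar | initBot => simp at hx
  | impL S G D A B =>
    simp only [List.mem_cons, List.not_mem_nil, or_false] at hx
    rcases hx with rfl | rfl
    · exact .inl hC
    · exact .inl (Multiset.mem_add.2 (.inr hC))
  | impR S G D A B =>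
    obtain rfl := List.mem_singleton.1 hx
    rcases Multiset.mem_add.1 hC with hC | hC
    · exact .inr ⟨A, B, Multiset.mem_singleton.1 hC, by simp⟩
    · exact .inl (Multiset.mem_add.2 (.inr hC))
  | box | boxp | cut => exact hr.elim

theorem PropStep.subset {s x : Sequent} (h : PropStep s x) {U : Finset Fm} (hU : SubClosed U)
    (hs : (∀ C ∈ s.ant, C ∈ U) ∧ ∀ C ∈ s.suc, C ∈ U) :
    (∀ C ∈ x.ant, C ∈ U) ∧ ∀ C ∈ x.suc, C ∈ U := by
  obtain ⟨r, l, hr, h, hx⟩ := h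
  obtain ⟨h₁, h₂⟩ := hs
  cases h with
  | initVar | initBot => simp at hx
  | impL S G D A B =>
    have := hU.imp (h₁ (imp A B) (by simp))
    simp only [List.mem_cons, List.not_mem_nil, or_false] at hx
    simp only [Multiset.mem_add, Multiset.mem_singleton] at h₁ h₂
    rcases hx with rfl | rfl <;> simp only [Multiset.mem_add, Multiset.mem_singleton] <;> grind
  | impR S G D A B =>
    have := hU.imp (h₂ (imp A B) (by simp))
    obtain rfl := List.mem_singleton.1 hx
    simp only [Multiset.mem_add, Multiset.mem_singleton] at h₁ h₂ ⊢
    grind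
  | box | boxp | cut => exact hr.elim

theorem mem_ant_of_reduces {s x : Sequent} (h : Relation.ReflTransGen PropStep s x) {C : Fm}
    (hC : C ∈ s.ant) (hi : ∀ A B, C ≠ imp A B) : C ∈ x.ant := by
  induction h with
  | refl => exact hC
  | tail _ h ih => exact (h.ant ih).resolve_right fun ⟨A, B, h, _⟩ => hi A B h

theorem mem_suc_of_reduces {s x : Sequent} (h : Relation.ReflTransGen PropStep s x) {C : Fm}
    (hC : C ∈ s.suc) (hi : ∀ A B, C ≠ imp A B) : C ∈ x.suc := by
  induction h with
  | refl => exact hC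
  | tail _ h ih => exact (h.suc ih).resolve_right fun ⟨A, B, h, _⟩ => hi A B h

theorem StepClosed.of_prop {S : Set Fm} {P : Set Sequent} (hP : StepClosed S P) {r : Rule}
    {s : Sequent} {l : List Sequent} (hr : r.IsProp) (h : RuleInst r s l) (hs : s.ctx = S)
    (hl : ∀ x ∈ l, x ∈ P) : s ∈ P := by
  refine hP (insert s {x | x ∈ l}) bot (l.finite_toSet.insert s) ?_ ?_ (Set.mem_insert _ _)
  · rintro x (rfl | hx)
    · exact hs
    · exact (h.ctx_eq x hx).trans hs
  · rintro x (rfl | hx)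
    · exact .prop hr h fun y hy => .inr hy
    · exact .mem (hl x hx)

theorem StepClosed.of_box {S : Set Fm} {P : Set Sequent} (hP : StepClosed S P) {B : Fm}
    {s p : Sequent} (h : RuleInst (Rule.box B) s [p]) (hs : s.ctx = S) (hp : p ∈ P) : s ∈ P :=
  hP {s} bot (Set.finite_singleton s) (by simpa using hs) (by simpa using .box h hp) rfl

/-! ### The countermodel of a sequent outside of a closed set -/

/-- The sequents of bounded weight with formulas from `U`. -/
def boundedSequents (S : Set Fm) (U : Finset Fm) (N : ℕ) : Set Sequent :=
  {s | s.ctx = S ∧ ((∀ C ∈ s.ant, C ∈ U) ∧ ∀ C ∈ s.suc, C ∈ U) ∧ s.weight ≤ N}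

theorem card_le_sum_weight (m : Multiset Fm) : m.card ≤ (m.map Fm.weight).sum := by
  induction m using Multiset.induction_on with
  | empty => simp
  | cons A m ih =>
    have := A.weight_pos
    simp only [Multiset.card_cons, Multiset.map_cons, Multiset.sum_cons]
    omega

theorem finite_boundedSequents (S : Set Fm) (U : Finset Fm) (N : ℕ) :
    (boundedSequents S U N).Finite := by
  classical
  have key : ∀ m : Multiset Fm, (∀ C ∈ m, C ∈ U) → m.card ≤ N → m ≤ N • U.val := by
    intro m hm hN
    refine Multiset.le_iff_count.2 fun C => ?_
    by_cases hC : C ∈ m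
    · rw [Multiset.count_nsmul, Multiset.count_eq_one_of_mem U.nodup (hm C hC), mul_one]
      exact (Multiset.count_le_card _ _).trans hN
    · simp [Multiset.count_eq_zero_of_notMem hC]
  have hfin : {m : Multiset Fm | m ≤ N • U.val}.Finite := by
    refine (N • U.val).powerset.finite_toSet.subset fun m hm => ?_
    simpa using hm
  refine ((hfin.prod hfin).image fun x => (⟨S, x.1, x.2⟩ : Sequent)).subset ?_
  rintro ⟨S', G, D⟩ ⟨rfl, ⟨hG, hD⟩, hw⟩
  have h₁ := card_le_sum_weight G
  have h₂ := card_le_sum_weight D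
  simp only [Sequent.weight] at hw
  exact ⟨(G, D), ⟨key G hG (by omega), key D hD (by omega)⟩, rfl⟩

theorem PropStep.bounded {S : Set Fm} {U : Finset Fm} {N : ℕ} (hU : SubClosed U) {s x : Sequent}
    (h : PropStep s x) (hs : s ∈ boundedSequents S U N) : x ∈ boundedSequents S U N :=
  ⟨h.ctx_eq.trans hs.1, h.subset hU hs.2.1, h.weight_lt.le.trans hs.2.2⟩

/-- The factor 5 counts the four repetition-free parts of `modalAnt` and the one-formula succedent,
each of weight at most that of `U`. -/
theorem modalAnt_bounded [DecidableEq Fm] {S : Set Fm} {U F : Finset Fm} {N : ℕ}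
    (hU : SubClosed U) (hF : F ⊆ U) (hN : 5 * (U.val.map Fm.weight).sum ≤ N) {G : Multiset Fm}
    (hG : ∀ C ∈ G, C ∈ U) {A : Fm} (hA : A ∈ U) :
    ⟨S, modalAnt F G, {A}⟩ ∈ boundedSequents S U N := by
  have hle : ∀ m : Multiset Fm, m.Nodup → (∀ C ∈ m, C ∈ U) →
      (m.map Fm.weight).sum ≤ (U.val.map Fm.weight).sum := by
    intro m hm hmU
    obtain ⟨k, hk⟩ := Multiset.le_iff_exists_add.1 ((Multiset.le_iff_subset hm).2 hmU)
    simp [hk]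
  have hb : ∀ C ∈ boxArgs G, C ∈ U := fun C hC => hU.box (hG _ (mem_boxArgs.1 hC))
  have hp : ∀ C ∈ boxpArgs G, C ∈ U := fun C hC => hU.boxp (hG _ (mem_boxpArgs.1 hC))
  refine ⟨rfl, ⟨fun C hC => ?_, by simpa using hA⟩, ?_⟩
  · rcases mem_modalAnt.1 hC with h | h | h | ⟨B, h, rfl⟩
    · exact hF h
    · exact hU.box (hG _ h)
    · exact hU.boxp (hG _ h)
    · exact hG _ h
  · have h₁ := hle F.val F.nodup hF
    have h₂ := hle _ (boxArgs G).nodup hb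
    have h₃ := hle _ (boxpArgs G).nodup hp
    have h₄ := hle ((boxpArgs G).val.map Fm.boxp)
      ((boxpArgs G).nodup.map fun _ _ h => by simpa using h) (by
        intro C hC
        obtain ⟨B, hB, rfl⟩ := Multiset.mem_map.1 hC
        exact hG _ (mem_boxpArgs.1 hB))
    have h₅ := hle {A} (Multiset.nodup_singleton A) (by simpa using hA)
    simp only [Sequent.weight, modalAnt, Multiset.map_add, Multiset.sum_add] at h₁ h₂ h₃ h₄ h₅ ⊢
    omega

/-- Saturated sequents outside of `P` among the bounded ones. -/
def openSequents (S : Set Fm) (U : Finset Fm) (N : ℕ) (P : Set Sequent) : Set Sequent :=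
  {s | s ∈ boundedSequents S U N ∧ Saturated s ∧ s ∉ P}

/-- If all premises of an implication rule were in `P`, so would be the conclusion; following a
premise outside `P` terminates because weights drop. -/
theorem StepClosed.exists_open {S : Set Fm} {U : Finset Fm} {N : ℕ} {P : Set Sequent}
    (hP : StepClosed S P) (hU : SubClosed U) {s : Sequent} (hs : s ∈ boundedSequents S U N)
    (hsP : s ∉ P) : ∃ x ∈ openSequents S U N P, Relation.ReflTransGen PropStep s x := by
  induction hn : s.weight using Nat.strong_induction_on generalizing s with
  | _ n ih =>
    subst hn
    by_cases hsat : Saturated s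
    · exact ⟨s, ⟨hs, hsat, hsP⟩, .refl⟩
    · simp only [Saturated, not_forall, not_not] at hsat
      obtain ⟨x, r, l, hr, h, _⟩ := hsat
      have : ∃ y ∈ l, y ∉ P := by
        by_contra! hl
        exact hsP (hP.of_prop hr h hs.1 hl)
      obtain ⟨y, hy, hyP⟩ := this
      have hstep : PropStep s y := ⟨r, l, hr, h, hy⟩
      obtain ⟨z, hz, hyz⟩ := ih _ hstep.weight_lt (hstep.bounded hU hs) hyP rfl
      exact ⟨z, hz, .head hstep hyz⟩

/-- Accessibility in the countermodel. -/
def OpenRel [DecidableEq Fm] (S : Set Fm) (F U : Finset Fm) (N : ℕ) (P : Set Sequent)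
    (s x : Sequent) : Prop :=
  x ∈ openSequents S U N P ∧
    ∃ D, Relation.ReflTransGen PropStep ⟨S, modalAnt F s.ant, D⟩ x

/-- Valuation in the countermodel. -/
def openVal (s : Sequent) (n : ℕ) : Prop := var n ∈ s.ant

/-- Stated for every `s` that reduces to the world `w`, since implications vanish on the way to a
saturated sequent and must be evaluated where they are decomposed. The essential case is □⁺A in the
succedent: were it true at `w`, a finite set `Y` containing `w` would satisfy the closure condition,
placing `w` in `P`. -/
theorem StepClosed.truth [DecidableEq Fm] {S : Set Fm} {F U : Finset Fm} {N : ℕ}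
    {P : Set Sequent} (hP : StepClosed S P) (hFS : (F : Set Fm) ⊆ S) (hU : SubClosed U)
    (hF : F ⊆ U) (hN : 5 * (U.val.map Fm.weight).sum ≤ N) (A : Fm) :
    ∀ s w, Relation.ReflTransGen PropStep s w → w ∈ openSequents S U N P →
      (A ∈ s.ant → Sat (OpenRel S F U N P) openVal w A) ∧
      (A ∈ s.suc → ¬ Sat (OpenRel S F U N P) openVal w A) := by
  induction A with
  | var n =>
    intro s w hsw hw
    refine ⟨fun h => mem_ant_of_reduces hsw h (by simp), fun h hv => hw.2.2 ?_⟩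
    have h := mem_suc_of_reduces hsw h (by simp)
    obtain ⟨S', G, D⟩ := w
    obtain ⟨G, rfl⟩ := Multiset.exists_cons_of_mem hv
    obtain ⟨D, rfl⟩ := Multiset.exists_cons_of_mem h
    have := RuleInst.initVar S' G D n
    rw [add_comm G, Multiset.singleton_add, Multiset.singleton_add] at this
    exact hP.of_prop (r := Rule.init) trivial this hw.1.1 (by simp)
  | bot =>
    intro s w hsw hw
    refine ⟨fun h => (hw.2.2 ?_).elim, fun _ h => h⟩
    have h := mem_ant_of_reduces hsw h (by simp)
    obtain ⟨S', G, D⟩ := w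
    obtain ⟨G, rfl⟩ := Multiset.exists_cons_of_mem h
    have := RuleInst.initBot S' G D
    rw [add_comm G, Multiset.singleton_add] at this
    exact hP.of_prop (r := Rule.init) trivial this hw.1.1 (by simp)
  | imp A B ihA ihB =>
    intro s w hsw hw
    induction hsw using Relation.ReflTransGen.head_induction_on with
    | refl => exact ⟨fun h => (hw.2.1.imp_notMem_ant A B h).elim,
        fun h => (hw.2.1.imp_notMem_suc A B h).elim⟩
    | @head s x hsx hxw ih =>
      refine ⟨fun h => ?_, fun h => ?_⟩
      · rcases hsx.ant h with h | ⟨_, _, he, h⟩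
        · exact ih.1 h
        · obtain ⟨rfl, rfl⟩ := Fm.imp.inj he
          rcases h with h | h
          · exact fun _ => (ihB x w hxw hw).1 h
          · exact fun hA => ((ihA x w hxw hw).2 h hA).elim
      · rcases hsx.suc h with h | ⟨_, _, he, h₁, h₂⟩
        · exact ih.2 h
        · obtain ⟨rfl, rfl⟩ := Fm.imp.inj he
          exact fun hAB => (ihB x w hxw hw).2 h₂ (hAB ((ihA x w hxw hw).1 h₁))
  | box A ih =>
    intro s w hsw hw
    refine ⟨fun h v hv => ?_, fun h hsat => ?_⟩
    · have h := mem_ant_of_reduces hsw h (by simp)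
      obtain ⟨hv, D, hr⟩ := hv
      exact (ih _ v hr hv).1 (mem_modalAnt.2 (.inr (.inl h)))
    · have h := mem_suc_of_reduces hsw h (by simp)
      have hr := ruleInst_box (F := F) (hw.1.1.symm ▸ hFS) h
      have hp : ⟨w.ctx, modalAnt F w.ant, {A}⟩ ∉ P := fun hp => hw.2.2 (hP.of_box hr hw.1.1 hp)
      rw [hw.1.1] at hp
      obtain ⟨x, hx, hpx⟩ := hP.exists_open hU (N := N)
        (modalAnt_bounded hU hF hN hw.1.2.1.1 (hU.box (hw.1.2.1.2 _ h))) hp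
      exact (ih _ x hpx hx).2 (Multiset.mem_singleton_self A) (hsat x ⟨hx, _, hpx⟩)
  | boxp A ih =>
    intro s w hsw hw
    refine ⟨fun h v hv => ?_, fun h hsat => ?_⟩
    · have h := mem_ant_of_reduces hsw h (by simp)
      have key : ∀ u v, boxp A ∈ u.ant → OpenRel S F U N P u v →
          boxp A ∈ v.ant ∧ Sat (OpenRel S F U N P) openVal v A := by
        rintro u v hu ⟨hv, D, hr⟩
        exact ⟨mem_ant_of_reduces hr (mem_modalAnt.2 (.inr (.inr (.inr ⟨A, hu, rfl⟩)))) (by simp),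
          (ih _ v hr hv).1 (mem_modalAnt.2 (.inr (.inr (.inl hu))))⟩
      have : boxp A ∈ v.ant ∧ Sat (OpenRel S F U N P) openVal v A := by
        induction hv with
        | single hv => exact key _ _ h hv
        | tail _ hv ih => exact key _ _ ih.1 hv
      exact this.2
    · have h := mem_suc_of_reduces hsw h (by simp)
      have hA : boxp A ∈ U := hw.1.2.1.2 _ h
      -- Membership is a condition on all open reducts, so it passes to premises of implication
      -- rules and holds vacuously for sequents without open reducts.
      set Y : Set Sequent := {y | y ∈ boundedSequents S U N ∧ ∀ v ∈ openSequents S U N P,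
        Relation.ReflTransGen PropStep y v → boxp A ∈ v.suc ∧
          ∀ u, Relation.TransGen (OpenRel S F U N P) v u →
            Sat (OpenRel S F U N P) openVal u A} with hY
      refine hw.2.2 (hP Y A ((finite_boundedSequents S U N).subset fun y hy => hy.1)
        (fun y hy => hy.1.1) ?_ ⟨hw.1, fun v _ hr => ?_⟩)
      · rintro y ⟨hyb, hy⟩
        by_cases hyP : y ∈ P
        · exact .mem hyP
        by_cases hsaty : Saturated y
        · obtain ⟨hyA, hys⟩ := hy y ⟨hyb, hsaty, hyP⟩ .refl
          have hr := ruleInst_boxp (F := F) (hyb.1.symm ▸ hFS) hyA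
          rw [hyb.1] at hr
          refine .boxp hr ?_ ⟨modalAnt_bounded hU hF hN hyb.2.1.1 hA, fun v hv hr => ?_⟩
          -- A left premise outside `P` would reduce to a successor of `y` refuting A, against □⁺A
          -- being true at `y`.
          · by_contra hp
            obtain ⟨x, hx, hpx⟩ := hP.exists_open hU (N := N)
              (modalAnt_bounded hU hF hN hyb.2.1.1 (hU.boxp hA)) hp
            exact (ih _ x hpx hx).2 (Multiset.mem_singleton_self A)
              (hys x (.single ⟨hx, _, hpx⟩))
          -- Open reducts of the right premise are successors of `y`, so whatever they reach is
          -- reached from `y`.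
          · exact ⟨mem_suc_of_reduces hr (Multiset.mem_singleton_self _) (by simp),
              fun u hu => hys u (.head ⟨hv, _, hr⟩ hu)⟩
        · simp only [Saturated, not_forall, not_not] at hsaty
          obtain ⟨x, r, l, hr, hi, _⟩ := hsaty
          refine .prop hr hi fun z hz => ?_
          have hstep : PropStep y z := ⟨r, l, hr, hi, hz⟩
          exact ⟨hstep.bounded hU hyb, fun v hv hzv => hy v hv (.head hstep hzv)⟩
      · rcases Relation.ReflTransGen.cases_head hr with rfl | ⟨x, hx, _⟩
        · exact ⟨h, hsat⟩
        · exact (hw.2.1 x hx).elim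

/-- A sequent outside of a closed set has a countermodel in which a given finite part of the
context holds at all accessible worlds. -/
theorem StepClosed.exists_countermodel {S : Set Fm} {P : Set Sequent} (hP : StepClosed S P)
    {F : Finset Fm} (hF : (F : Set Fm) ⊆ S) {G D : Multiset Fm} (hs : ⟨S, G, D⟩ ∉ P) :
    ∃ (W : Type) (R : W → W → Prop) (V : W → ℕ → Prop) (w : W),
      (∀ u v, R u v → ∀ B ∈ F, Sat R V v B) ∧ (∀ B ∈ G, Sat R V w B) ∧
        ∀ B ∈ D, ¬ Sat R V w B := by
  classical
  obtain ⟨U, hFU, hU⟩ := exists_subClosed (F ∪ G.toFinset ∪ D.toFinset)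
  have hFU' : F ⊆ U := fun C hC => hFU (by simp [hC])
  -- Room for all canonical modal premises and for the initial sequent.
  set N := 5 * (U.val.map Fm.weight).sum + (⟨S, G, D⟩ : Sequent).weight with hN
  have hsb : ⟨S, G, D⟩ ∈ boundedSequents S U N :=
    ⟨rfl, ⟨fun C hC => hFU (by simp_all), fun C hC => hFU (by simp_all)⟩, by simp [hN]⟩
  obtain ⟨w, hw, hsw⟩ := hP.exists_open hU hsb hs
  have truth := hP.truth hF hU hFU' (N := N) (by simp [hN])
  refine ⟨Sequent, OpenRel S F U N P, openVal, w, ?_, fun B hB => (truth B _ w hsw hw).1 hB,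
    fun B hB => (truth B _ w hsw hw).2 hB⟩
  rintro u v ⟨hv, D, hr⟩ B hB
  exact (truth B _ v hr hv).1 (mem_modalAnt.2 (.inl hB))

/-! ### Soundness of `∞`-proofs with cut -/

/-- The sequent with another context. -/
def Sequent.withCtx (T : Set Fm) (s : Sequent) : Sequent := ⟨T, s.ant, s.suc⟩

/-- A rule instance uses only finitely many formulas from the context. -/
theorem RuleInst.exists_finite_ctx {r : Rule} {s : Sequent} {l : List Sequent}
    (h : RuleInst r s l) : ∃ F : Finset Fm, (F : Set Fm) ⊆ s.ctx ∧
      ∀ T : Set Fm, (F : Set Fm) ⊆ T → RuleInst r (s.withCtx T) (l.map (Sequent.withCtx T)) := by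
  cases h with
  | initVar S G D p => exact ⟨∅, by simp, fun T _ => .initVar T G D p⟩
  | initBot S G D => exact ⟨∅, by simp, fun T _ => .initBot T G D⟩
  | impL S G D A B => exact ⟨∅, by simp, fun T _ => .impL T G D A B⟩
  | impR S G D A B => exact ⟨∅, by simp, fun T _ => .impR T G D A B⟩
  | box S S₀ hS L P F R A => exact ⟨S₀, hS, fun T hT => .box T S₀ hT L P F R A⟩
  | boxp S S₀ hS L P F R A => exact ⟨S₀, hS, fun T hT => .boxp T S₀ hT L P F R A⟩
  | cut S G D A => exact ⟨∅, by simp, fun T _ => .cut T G D A⟩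

section Soundness

variable {W : Type} {R : W → W → Prop} {V : W → ℕ → Prop}

/-- All formulas of the antecedent are true at `w` and all formulas of the succedent false. -/
def Sequent.RefutedAt (R : W → W → Prop) (V : W → ℕ → Prop) (s : Sequent) (w : W) : Prop :=
  (∀ B ∈ s.ant, Sat R V w B) ∧ ∀ B ∈ s.suc, ¬ Sat R V w B

/-- Some path of length `n + 1` from `w` leads to a world where `A` is false. -/
def FailsAt (R : W → W → Prop) (V : W → ℕ → Prop) (A : Fm) : ℕ → W → Prop
  | 0, w => ∃ v, R w v ∧ ¬ Sat R V v A
  | n + 1, w => ∃ v, R w v ∧ FailsAt R V A n v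

theorem FailsAt.not_sat {A : Fm} {n : ℕ} {w : W} (h : FailsAt R V A n w) :
    ¬ Sat R V w (boxp A) := by
  induction n generalizing w with
  | zero =>
    obtain ⟨v, hv, h⟩ := h
    exact fun hw => h (hw v (.single hv))
  | succ n ih =>
    obtain ⟨v, hv, h⟩ := h
    exact fun hw => ih h fun u hu => hw u (.head hv hu)

theorem exists_failsAt {A : Fm} {w : W} (h : ¬ Sat R V w (boxp A)) : ∃ n, FailsAt R V A n w := by
  simp only [Sat, not_forall] at h
  obtain ⟨v, hv, h⟩ := h
  induction hv using Relation.TransGen.head_induction_on with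
  | single hv => exact ⟨0, v, hv, h⟩
  | head hu _ ih =>
    obtain ⟨n, hn⟩ := ih
    exact ⟨n + 1, _, hu, hn⟩

/-- The least length of a path from `w` that refutes `Box⁺ A`, minus one. -/
noncomputable def failDist (R : W → W → Prop) (V : W → ℕ → Prop) (A : Fm) (w : W) : ℕ :=
  sInf {n | FailsAt R V A n w}

/-- The rule does not change the world at which a sequent is considered. -/
def Rule.IsLocal : Rule → Prop
  | box _ => False
  | boxp _ => False
  | _ => True

/-- A refuted conclusion has a refuted premise, possibly at a successor world. For (□⁺) the
successor lies on a shortest path to a failure of A: if it is the endpoint, the left premise is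
refuted; otherwise the right one is, at a smaller distance. -/
theorem RuleInst.exists_refuted {r : Rule} {s : Sequent} {l : List Sequent} (h : RuleInst r s l)
    (hS : ∀ u v, R u v → ∀ B ∈ s.ctx, Sat R V v B) {w : W} (hs : s.RefutedAt R V w) :
    ∃ (i : ℕ) (x : Sequent) (v : W), l[i]? = some x ∧ x.RefutedAt R V v ∧
      (r.IsLocal → v = w) ∧
      ∀ A, r = Rule.boxp A → i ≠ 0 → failDist R V A v < failDist R V A w := by
  have modal : ∀ (S₀ : Finset Fm) (L P F : Multiset Fm) (v : W), (S₀ : Set Fm) ⊆ s.ctx → R w v →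
      (∀ B ∈ F + L.map Fm.box + P.map Fm.boxp, Sat R V w B) →
      ∀ B ∈ S₀.val + L + P + P.map Fm.boxp, Sat R V v B := by
    intro S₀ L P F v hS₀ hv hw B hB
    simp only [Multiset.mem_add, Multiset.mem_map] at hB hw
    rcases hB with ((hB | hB) | hB) | ⟨C, hC, rfl⟩
    · exact hS w v hv B (hS₀ hB)
    · exact hw (Fm.box B) (.inl (.inr ⟨B, hB, rfl⟩)) v hv
    · exact hw (Fm.boxp B) (.inr ⟨B, hB, rfl⟩) v (.single hv)
    · exact fun u hu => hw (Fm.boxp C) (.inr ⟨C, hC, rfl⟩) u (.head hv hu)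
  obtain ⟨h₁, h₂⟩ := hs
  cases h with
  | initVar S G D p => exact (h₂ (var p) (by simp) (h₁ (var p) (by simp))).elim
  | initBot S G D => exact (h₁ bot (by simp)).elim
  | impL S G D A B =>
    have hAB : Sat R V w A → Sat R V w B := h₁ (imp A B) (by simp)
    simp only [Multiset.mem_add, Multiset.mem_singleton] at h₁ h₂
    by_cases hA : Sat R V w A
    · refine ⟨0, _, w, rfl, ⟨?_, h₂⟩, fun _ => rfl, by simp⟩
      simp only [Multiset.mem_add, Multiset.mem_singleton]
      rintro C (hC | rfl)
      · exact h₁ C (.inl hC)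
      · exact hAB hA
    · refine ⟨1, _, w, rfl, ⟨fun C hC => h₁ C (.inl hC), ?_⟩, fun _ => rfl, by simp⟩
      simp only [Multiset.mem_add, Multiset.mem_singleton]
      rintro C (rfl | hC)
      · exact hA
      · exact h₂ C hC
  | impR S G D A B =>
    have hAB := h₂ (imp A B) (by simp)
    simp only [Sat, not_forall] at hAB
    obtain ⟨hA, hB⟩ := hAB
    simp only [Multiset.mem_add, Multiset.mem_singleton] at h₁ h₂
    refine ⟨0, _, w, rfl, ⟨?_, ?_⟩, fun _ => rfl, by simp⟩
    · simp only [Multiset.mem_add, Multiset.mem_singleton]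
      rintro C (hC | rfl)
      · exact h₁ C hC
      · exact hA
    · simp only [Multiset.mem_add, Multiset.mem_singleton]
      rintro C (rfl | hC)
      · exact hB
      · exact h₂ C (.inr hC)
  | box S S₀ hS₀ L P F D A =>
    have hA := h₂ (Fm.box A) (by simp)
    simp only [Sat, not_forall] at hA
    obtain ⟨v, hv, hA⟩ := hA
    exact ⟨0, _, v, rfl, ⟨modal S₀ L P F v hS₀ hv h₁, by simpa using hA⟩, False.elim, by simp⟩
  | boxp S S₀ hS₀ L P F D A =>
    have hne := exists_failsAt (h₂ (Fm.boxp A) (by simp))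
    have hmem : FailsAt R V A (failDist R V A w) w := Nat.sInf_mem hne
    cases hd : failDist R V A w with
    | zero =>
      rw [hd] at hmem
      obtain ⟨v, hv, hA⟩ := hmem
      exact ⟨0, _, v, rfl, ⟨modal S₀ L P F v hS₀ hv h₁, by simpa using hA⟩, False.elim, by simp⟩
    | succ n =>
      rw [hd] at hmem
      obtain ⟨v, hv, hA⟩ := hmem
      refine ⟨1, _, v, rfl, ⟨modal S₀ L P F v hS₀ hv h₁, by simpa using hA.not_sat⟩,
        False.elim, ?_⟩
      intro B hB _
      obtain rfl := Rule.boxp.inj hB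
      rw [hd]
      exact Nat.lt_succ_of_le (Nat.sInf_le hA)
  | cut S G D A =>
    by_cases hA : Sat R V w A
    · refine ⟨1, _, w, rfl, ⟨?_, h₂⟩, fun _ => rfl, by simp⟩
      simp only [Multiset.mem_add, Multiset.mem_singleton]
      rintro C (hC | rfl)
      · exact h₁ C hC
      · exact hA
    · refine ⟨0, _, w, rfl, ⟨h₁, ?_⟩, fun _ => rfl, by simp⟩
      simp only [Multiset.mem_add, Multiset.mem_singleton]
      rintro C (rfl | hC)
      · exact hA
      · exact h₂ C hC

open SeqTree

/-- Refuted premises trace an infinite branch. In its good tail the distance to a failure of the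
fixed A is unchanged by local rules and drops at each (□⁺), which occurs infinitely often:
impossible in ℕ. The rules are reread with context `F`, so the model has to satisfy only `F`. -/
theorem SeqTree.IsInfProof.sound {t : SeqTree} (ht : t.IsInfProof) {F : Set Fm}
    (hctx : ∀ a, t.IsNode a → ∃ r s l, t a = some s ∧ RuleInst r s l ∧
      (∀ i : ℕ, t (a ++ [i]) = l[i]?) ∧ RuleInst r (s.withCtx F) (l.map (Sequent.withCtx F)))
    (hF : ∀ u v, R u v → ∀ B ∈ F, Sat R V v B) {s : Sequent} (hs : t [] = some s) (w : W) :
    ¬ s.RefutedAt R V w := by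
  intro hw
  have step : ∀ x : {x : List ℕ × W // ∃ s, t x.1 = some s ∧ s.RefutedAt R V x.2},
      ∃ (i : ℕ) (y : {x : List ℕ × W // ∃ s, t x.1 = some s ∧ s.RefutedAt R V x.2}) (r : Rule),
        y.1.1 = x.1.1 ++ [i] ∧ t.AppliesAt x.1.1 r ∧ (r.IsLocal → y.1.2 = x.1.2) ∧
        ∀ A, r = Rule.boxp A → i ≠ 0 → failDist R V A y.1.2 < failDist R V A x.1.2 := by
    rintro ⟨⟨a, w⟩, s, hs, hw⟩
    obtain ⟨r, s', l, hs', hr, hl, hrF⟩ := hctx a (by simp [IsNode, show t a = some s from hs])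
    obtain rfl : s = s' := Option.some.inj (hs.symm.trans hs')
    obtain ⟨i, x, v, hx, hxv, h₁, h₂⟩ := hrF.exists_refuted hF (w := w) hw
    rw [List.getElem?_map, Option.map_eq_some_iff] at hx
    obtain ⟨y, hy, rfl⟩ := hx
    exact ⟨i, ⟨(a ++ [i], v), y, (hl i).trans hy, hxv⟩, r, rfl, ⟨s, l, hs, hr, hl⟩, h₁, h₂⟩
  choose dir next rule hnext happ hlocal hdist using step
  let path : ℕ → {x : List ℕ × W // ∃ s, t x.1 = some s ∧ s.RefutedAt R V x.2} := fun n =>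
    next^[n] ⟨([], w), s, hs, hw⟩
  have hpath : ∀ n, path (n + 1) = next (path n) := fun n => Function.iterate_succ_apply' _ _ _
  have hbranch : ∀ n, branchNode (fun n => dir (path n)) n = (path n).1.1 := by
    intro n
    induction n with
    | zero => rfl
    | succ n ih => rw [branchNode_succ, ih, hpath, hnext]
  obtain ⟨N, A, h₁, h₂, h₃, h₄⟩ := ht.branches (fun n => dir (path n)) fun n => by
    obtain ⟨s, hs, _⟩ := (path n).2
    rw [hbranch, IsNode, hs]
    rfl
  simp only [hbranch] at h₁ h₂ h₃ h₄
  have hle : ∀ n ≥ N, failDist R V A (path (n + 1)).1.2 ≤ failDist R V A (path n).1.2 ∧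
      (∀ B, t.AppliesAt (path n).1.1 (Rule.boxp B) →
        failDist R V A (path (n + 1)).1.2 < failDist R V A (path n).1.2) := by
    intro n hn
    have hr := happ (path n)
    rw [hpath]
    have hlt : ∀ B, t.AppliesAt (path n).1.1 (Rule.boxp B) →
        failDist R V A (next (path n)).1.2 < failDist R V A (path n).1.2 := by
      intro B hB
      have := h₁ n hn B hB
      subst this
      exact hdist (path n) B (hr.unique hB) (h₃ n hn B hB)
    refine ⟨?_, hlt⟩
    cases hrule : rule (path n) with
    | box B => exact (h₄ n hn B (hrule ▸ hr)).elim
    | boxp B => exact (hlt B (hrule ▸ hr)).le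
    | init | impL | impR | cut => rw [hlocal (path n) (by rw [hrule]; trivial)]
  have hanti : ∀ n ≥ N, ∀ k, failDist R V A (path (n + k)).1.2 ≤ failDist R V A (path n).1.2 := by
    intro n hn k
    induction k with
    | zero => rfl
    | succ k ih => exact ((hle (n + k) (by omega)).1).trans ih
  have hfalse : ∀ d, ∀ n ≥ N, failDist R V A (path n).1.2 = d → False := by
    intro d
    induction d using Nat.strong_induction_on with
    | _ d ih =>
      rintro n hn rfl
      obtain ⟨m, hm, hN, ⟨B, hB⟩, _⟩ := h₂ n
      obtain ⟨k, rfl⟩ := Nat.exists_eq_add_of_le hm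
      exact ih _ (((hle _ hN).2 B hB).trans_le (hanti n hn k)) _ (by omega) rfl
  exact hfalse _ N le_rfl rfl

end Soundness

/-- A regular `∞`-proof uses only finitely many formulas from the context. -/
theorem SeqTree.Regular.exists_finite_ctx {t : SeqTree} (hreg : t.Regular) (ht : t.IsInfProof)
    {s : Sequent} (hs : t [] = some s) : ∃ F : Finset Fm, (F : Set Fm) ⊆ s.ctx ∧
      ∀ a, t.IsNode a → ∃ r s l, t a = some s ∧ RuleInst r s l ∧
        (∀ i : ℕ, t (a ++ [i]) = l[i]?) ∧
          RuleInst r (s.withCtx F) (l.map (Sequent.withCtx F)) := by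
  classical
  have hctx : ∀ a x, t a = some x → x.ctx = s.ctx := by
    intro a
    induction a using List.reverseRecOn with
    | nil =>
      intro x hx
      rw [Option.some.inj (hx.symm.trans hs)]
    | append_singleton a i ih =>
      intro x hx
      obtain ⟨r, y, l, hy, hr, hl⟩ := ht.rules a (ht.closed a i (by simp [IsNode, hx]))
      exact (hr.ctx_eq x (List.mem_of_getElem? ((hl i).symm.trans hx))).trans (ih y hy)
  -- The finite part is chosen per subtree, not per address, so that regularity makes the union
  -- finite.
  have hloc : ∀ u : SeqTree, ∃ F : Finset Fm, (∃ a, t.IsNode a ∧ u = t.subtree a) →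
      (F : Set Fm) ⊆ s.ctx ∧ ∃ r s l, u [] = some s ∧ RuleInst r s l ∧
        (∀ i : ℕ, u [i] = l[i]?) ∧ ∀ T : Set Fm, (F : Set Fm) ⊆ T →
          RuleInst r (s.withCtx T) (l.map (Sequent.withCtx T)) := by
    intro u
    by_cases h : ∃ a, t.IsNode a ∧ u = t.subtree a
    · obtain ⟨a, ha, rfl⟩ := h
      obtain ⟨r, x, l, hx, hr, hl⟩ := ht.rules a ha
      obtain ⟨F, hF, hT⟩ := hr.exists_finite_ctx
      exact ⟨F, fun _ => ⟨hctx a x hx ▸ hF, r, x, l, by simpa [subtree] using hx, hr, hl, hT⟩⟩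
    · exact ⟨∅, fun h' => (h h').elim⟩
  choose F hF using hloc
  refine ⟨hreg.toFinset.biUnion F, ?_, fun a ha => ?_⟩
  · simp only [Finset.coe_biUnion, Set.iUnion_subset_iff]
    exact fun u hu => (hF u (hreg.mem_toFinset.1 hu)).1
  · have hu : ∃ c, t.IsNode c ∧ t.subtree a = t.subtree c := ⟨a, ha, rfl⟩
    obtain ⟨_, r, x, l, hx, hr, hl, hT⟩ := hF _ hu
    refine ⟨r, x, l, by simpa [subtree] using hx, hr, hl, hT _ ?_⟩
    exact Finset.coe_subset.2 (Finset.subset_biUnion_of_mem F (hreg.mem_toFinset.2 hu))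

/-! ### Assembling the equivalences -/

theorem RegCutFreeProvable.regProvable {s : Sequent} (h : RegCutFreeProvable s) :
    RegProvable s := by
  obtain ⟨t, ht, hs, hr, _⟩ := h
  exact ⟨t, ht, hs, hr⟩

theorem Derives.regCutFreeProvable {S : Set Fm} {G : Multiset Fm} {A : Fm}
    (h : Derives S {B | B ∈ G} A) : RegCutFreeProvable ⟨S, G, {A}⟩ := by
  by_contra hn
  obtain ⟨F, E, hF, hE, hd⟩ := (derives_iff_hil.1 h).compact
  obtain ⟨W, R, V, w, hR, hG, hA⟩ := (stepClosed_regCutFree S).exists_countermodel hF hn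
  refine hA A (Multiset.mem_singleton_self A) (hd.sound w (fun v hv B hB => ?_)
    fun B hB => hG B (hE hB))
  -- The model guarantees `F` at endpoints of single steps; a nonempty path ends with one.
  obtain ⟨u, _, hu⟩ := Relation.TransGen.tail'_iff.1 hv
  exact hR u v hu B hB

theorem RegProvable.derives {S : Set Fm} {G : Multiset Fm} {A : Fm}
    (h : RegProvable ⟨S, G, {A}⟩) : Derives S {B | B ∈ G} A := by
  by_contra hn
  obtain ⟨t, ht, hs, hreg⟩ := h
  obtain ⟨F, hF, hctx⟩ := hreg.exists_finite_ctx ht hs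
  have hP : (⟨S, G, {A}⟩ : Sequent) ∉ {s | Refutes ∅ s} := fun h => hn <| derives_iff_hil.2 <|
    Hil.by_contra (Hil.weaken h fun C => by simp)
  obtain ⟨W, R, V, w, hR, hG, hA⟩ := (stepClosed_refutes S).exists_countermodel hF hP
  exact ht.sound hctx hR hs w ⟨hG, hA⟩

end KPlus

theorem mainTheorem5 (S : Set KPlus.Fm) (G : Multiset KPlus.Fm) (A : KPlus.Fm) :
    (KPlus.Derives S {B | B ∈ G} A ↔ KPlus.RegProvable ⟨S, G, {A}⟩) ∧
      (KPlus.Derives S {B | B ∈ G} A ↔ KPlus.RegCutFreeProvable ⟨S, G, {A}⟩) :=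
  ⟨⟨fun h => h.regCutFreeProvable.regProvable, fun h => h.derives⟩,
    ⟨fun h => h.regCutFreeProvable, fun h => h.regProvable.derives⟩⟩
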